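/- Let $p$ be an odd prime and let $C\subseteq\mathbb{P}^2$ be a smooth plane curve defined over $\mathbb{F}_p$ of degree $d$, where $1\le d\le p+1$. Then there is a line $L\subseteq\mathbb{P}^2$ defined over $\mathbb{F}_p$ which meets $C$ transversely, that is, such that $C\cap L$ consists of exactly $d$ distinct geometric points (points with coordinates in $\overline{\mathbb{F}_p}$). -/

import Mathlib

namespace PlaneGeometry

/-- The geometric points of the projective plane over `k`: points of `ℙ²` with coordinates in an
algebraic closure of `k`. -/
abbrev GeomPoint (k : Type*) [Field k] : Type _ :=
  Projectivization (AlgebraicClosure k) (Fin 3 → AlgebraicClosure k)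

/-- A plane curve of degree `degree ≥ 1` defined over `k`, given by its equation, a nonzero
homogeneous ternary form with coefficients in `k`. -/
structure PlaneCurve (k : Type*) [Field k] where
  form : MvPolynomial (Fin 3) k
  degree : ℕ
  degree_pos : 1 ≤ degree
  form_ne_zero : form ≠ 0
  isHomogeneous : form.IsHomogeneous degree

/-- The set of geometric points of a plane curve (by homogeneity, the choice of homogeneous
coordinates is irrelevant). -/
def PlaneCurve.geomPoints {k : Type*} [Field k] (C : PlaneCurve k) : Set (GeomPoint k) :=
  {P | MvPolynomial.aeval P.rep C.form = 0}

/-- A plane curve is smooth if at each of its geometric points some partial derivative of its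
equation does not vanish (Jacobian criterion). -/
def PlaneCurve.IsSmooth {k : Type*} [Field k] (C : PlaneCurve k) : Prop :=
  ∀ P ∈ C.geomPoints, ∃ i : Fin 3, MvPolynomial.aeval P.rep (MvPolynomial.pderiv i C.form) ≠ 0

/-- A line in `ℙ²` defined over `k`, as a `k`-point of the dual plane: `[a : b : c]` stands for the
line `a x + b y + c z = 0`. -/
abbrev RatLine (k : Type*) [Field k] : Type _ := Projectivization k (Fin 3 → k)

/-- The set of geometric points of a line defined over `k`. -/
def RatLine.geomPoints {k : Type*} [Field k] (L : RatLine k) : Set (GeomPoint k) :=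
  {P | ∑ i, algebraMap k (AlgebraicClosure k) (L.rep i) * P.rep i = 0}

/-- The line `L` meets the curve `C` transversely: `C ∩ L` consists of exactly `deg C` distinct
geometric points. -/
def MeetsTransversely {k : Type*} [Field k] (L : RatLine k) (C : PlaneCurve k) : Prop :=
  (C.geomPoints ∩ RatLine.geomPoints L).encard = C.degree

end PlaneGeometry

/-!
Let `f = 0` be a smooth plane curve of degree `d ≤ p + 1` over `𝔽_p`, write `Φ` for the Frobenius
`x ↦ xᵖ` of the plane over the algebraic closure, and suppose that every line `L` over `𝔽_p` is
tangent to the curve at some point `P L`. A smooth curve has one tangent line at each point, so that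
the points `P L` are distinct. The auxiliary form is `h = ∑ xⱼᵖ ∂ⱼ f`, of degree `d + p - 1`, which
vanishes at a point of the curve if and only if the tangent line there passes through the image of
the point under `Φ`. In particular `h` vanishes at all `P L`.

*The generic case, `f ∤ h`* (`exists_forall_not_isTangentAt_of_not_dvd`). If `P L` is not rational,
then `Φ (P L)` is a second point of tangency of `L` and a second zero of `f` and `h`. If `P L` is
rational, then `h` vanishes at `P L` to second order along `L`. Since a smooth curve is irreducible
(`irreducible_of_forall_grad_ne_zero`), Bézout's inequality in the form `card_add_card_le_mul`
applies, and gives `2 (p² + p + 1) ≤ d (d + p - 1) ≤ 2 p (p + 1)`, a contradiction. That inequality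
is proved by comparing dimensions of spaces of forms of large degree: the ideal `(f, h)` has
codimension at most the product of the degrees there, and it is annihilated by the evaluations at
the points and by the derivatives at the rational ones, which are linearly independent functionals.

*The exceptional case, `f ∣ h`* (`exists_forall_not_isTangentAt_of_dvd`). For a nonrational point
`P = P L` put `q(t) = f (P + t Φ(P))`. Since `(P + t Φ(P))ᵖ ≡ Φ(P)` modulo `tᵖ`, the divisibility
`f ∣ h` becomes `q' ≡ q g` modulo `tᵖ` for some `g`, and `q(0) = 0` then forces `tᵖ ∣ q`. On the
other hand `q`, regarded as a form of degree `d ≤ p + 1` on the line, has a double zero at `Φ(P)`.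
So `q = 0`, and the line is contained in the curve, which is impossible for a smooth curve of degree
at least two (`exists_singular_of_line`). Hence all `P L` are rational, and since there are as many
rational points as rational lines, all rational points lie on the curve. Then a rational line `L`
meets the curve in `p + 1` points, with multiplicity at least two at `P L`, and is again contained
in the curve. The case `d = 1`, in which the curve is itself a line, is immediate.

Finally, a line which is nowhere tangent meets the curve in `d` points, as the restriction of `f` to
the line has no multiple roots (`encard_inter_eq_of_forall_not_isTangentAt`).
-/

namespace PlaneGeometry

open MvPolynomial

/-! ### Restriction of a form to a line, and directional derivatives -/

section Restriction

variable {σ : Type*} {K : Type*} [Field K]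

/-- The restriction of the polynomial `f` to the parametrized line `t ↦ u + t w`, as a polynomial in
the parameter. -/
noncomputable def lineRestrict (f : MvPolynomial σ K) (u w : σ → K) : Polynomial K :=
  aeval (fun i => Polynomial.C (u i) + Polynomial.X * Polynomial.C (w i)) f

/-- The derivative `∑ wᵢ ∂ᵢ f` of `f` in the constant direction `w`. -/
noncomputable def dirDeriv [Fintype σ] (w : σ → K) (f : MvPolynomial σ K) : MvPolynomial σ K :=
  ∑ i, C (w i) * pderiv i f

lemma eval_lineRestrict (f : MvPolynomial σ K) (u w : σ → K) (t : K) :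
    (lineRestrict f u w).eval t = eval (u + t • w) f := by
  have := MvPolynomial.hom_eval₂ f (algebraMap K (Polynomial K)) (Polynomial.evalRingHom t)
    (fun i => Polynomial.C (u i) + Polynomial.X * Polynomial.C (w i))
  rw [lineRestrict, aeval_def, ← Polynomial.coe_evalRingHom, this, eval, coe_eval₂Hom]
  congr 1
  · ext; simp
  · ext i; simp [mul_comm t]

lemma lineRestrict_mul (f g : MvPolynomial σ K) (u w : σ → K) :
    lineRestrict (f * g) u w = lineRestrict f u w * lineRestrict g u w :=
  map_mul _ _ _

lemma lineRestrict_sum {ι : Type*} (s : Finset ι) (f : ι → MvPolynomial σ K) (u w : σ → K) :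
    lineRestrict (∑ i ∈ s, f i) u w = ∑ i ∈ s, lineRestrict (f i) u w :=
  map_sum _ _ _

@[simp] lemma lineRestrict_C (c : K) (u w : σ → K) :
    lineRestrict (C c) u w = Polynomial.C c := by
  simp [lineRestrict]

@[simp] lemma lineRestrict_X (i : σ) (u w : σ → K) :
    lineRestrict (X i) u w = Polynomial.C (u i) + Polynomial.X * Polynomial.C (w i) := by
  simp [lineRestrict]

lemma lineRestrict_eq_zero_iff [Infinite K] {f : MvPolynomial σ K} {u w : σ → K} :
    lineRestrict f u w = 0 ↔ ∀ t : K, eval (u + t • w) f = 0 := by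
  refine ⟨fun h t => by rw [← eval_lineRestrict, h, Polynomial.eval_zero], fun h => ?_⟩
  exact Polynomial.funext fun t => by rw [eval_lineRestrict, h, Polynomial.eval_zero]

section Fintype

variable [Fintype σ]

lemma eval_dirDeriv (w : σ → K) (f : MvPolynomial σ K) (x : σ → K) :
    eval x (dirDeriv w f) = ∑ i, w i * eval x (pderiv i f) := by
  simp [dirDeriv]

lemma dirDeriv_add (w : σ → K) (f g : MvPolynomial σ K) :
    dirDeriv w (f + g) = dirDeriv w f + dirDeriv w g := by
  simp [dirDeriv, mul_add, Finset.sum_add_distrib]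

lemma dirDeriv_mul (w : σ → K) (f g : MvPolynomial σ K) :
    dirDeriv w (f * g) = dirDeriv w f * g + f * dirDeriv w g := by
  simp only [dirDeriv, Finset.sum_mul, Finset.mul_sum, ← Finset.sum_add_distrib, pderiv_mul]
  exact Finset.sum_congr rfl fun i _ => by ring

lemma dirDeriv_C (w : σ → K) (c : K) : dirDeriv w (C c : MvPolynomial σ K) = 0 := by
  simp [dirDeriv]

lemma dirDeriv_X (w : σ → K) (j : σ) : dirDeriv w (X j : MvPolynomial σ K) = C (w j) := by
  classical
  simp [dirDeriv, pderiv_X, Pi.single_apply]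

lemma isHomogeneous_dirDeriv {f : MvPolynomial σ K} {d : ℕ} (hf : f.IsHomogeneous d) (w : σ → K) :
    (dirDeriv w f).IsHomogeneous (d - 1) :=
  IsHomogeneous.sum _ _ _ fun _ _ => hf.pderiv.C_mul _

lemma derivative_lineRestrict (f : MvPolynomial σ K) (u w : σ → K) :
    Polynomial.derivative (lineRestrict f u w) = lineRestrict (dirDeriv w f) u w := by
  induction f using MvPolynomial.induction_on with
  | C c => simp [dirDeriv, lineRestrict]
  | add f g hf hg =>
    rw [dirDeriv_add, lineRestrict, map_add, map_add, ← lineRestrict, ← lineRestrict, hf, hg]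
    exact (map_add _ _ _).symm
  | mul_X f i hf =>
    rw [dirDeriv_mul, dirDeriv_X, lineRestrict_mul, Polynomial.derivative_mul, hf]
    conv_rhs => rw [lineRestrict, map_add, ← lineRestrict, ← lineRestrict, lineRestrict_mul,
      lineRestrict_mul]
    simp

/-- Euler's identity, evaluated at a point. -/
lemma eval_dirDeriv_self {f : MvPolynomial σ K} {d : ℕ} (hf : f.IsHomogeneous d) (x : σ → K) :
    eval x (dirDeriv x f) = d * eval x f := by
  have := congrArg (eval x) hf.sum_X_mul_pderiv
  simpa [eval_dirDeriv] using this

end Fintype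

lemma eval_smul_of_isHomogeneous {f : MvPolynomial σ K} {d : ℕ} (hf : f.IsHomogeneous d) (c : K)
    (x : σ → K) : eval (c • x) f = c ^ d * eval x f := by
  rw [eval_eq, eval_eq, Finset.mul_sum]
  refine Finset.sum_congr rfl fun s hs => ?_
  simp only [Pi.smul_apply, smul_eq_mul, mul_pow, Finset.prod_mul_distrib,
    Finset.prod_pow_eq_pow_sum]
  rw [hf.degree_eq_sum_deg_support hs]
  ring

lemma natDegree_lineRestrict_le {f : MvPolynomial σ K} {d : ℕ} (hf : f.IsHomogeneous d)
    (u w : σ → K) : (lineRestrict f u w).natDegree ≤ d := by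
  have := aeval_natDegree_le (n := 1) f hf.totalDegree_le
    (fun i => Polynomial.C (u i) + Polynomial.X * Polynomial.C (w i)) (fun i => by compute_degree)
  rwa [mul_one] at this

lemma natDegree_le_and_coeff_prod_linear_pow (S : Finset σ) (s : σ →₀ ℕ) (u w : σ → K) :
    (∏ i ∈ S, (Polynomial.C (u i) + Polynomial.X * Polynomial.C (w i)) ^ s i).natDegree ≤
      ∑ i ∈ S, s i ∧
    (∏ i ∈ S, (Polynomial.C (u i) + Polynomial.X * Polynomial.C (w i)) ^ s i).coeff
      (∑ i ∈ S, s i) = ∏ i ∈ S, w i ^ s i := by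
  classical
  induction S using Finset.induction_on with
  | empty => simp
  | insert i S hi ih =>
    have h1 : (Polynomial.C (u i) + Polynomial.X * Polynomial.C (w i)).natDegree ≤ 1 := by
      compute_degree
    have h2 : ((Polynomial.C (u i) + Polynomial.X * Polynomial.C (w i)) ^ s i).natDegree ≤ s i := by
      simpa using Polynomial.natDegree_pow_le_of_le (s i) h1
    have h3 := Polynomial.coeff_pow_of_natDegree_le (m := s i) h1
    rw [Finset.prod_insert hi, Finset.sum_insert hi, Finset.prod_insert hi]
    refine ⟨Polynomial.natDegree_mul_le_of_le h2 ih.1, ?_⟩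
    rw [Polynomial.coeff_mul_add_eq_of_natDegree_le h2 ih.1, ih.2]
    rw [mul_one] at h3
    rw [h3]
    simp

/-- The top coefficient of the restriction of a form to the line `t ↦ u + t w` is its value at the
point at infinity `w` of the line. -/
lemma coeff_lineRestrict {f : MvPolynomial σ K} {d : ℕ} (hf : f.IsHomogeneous d) (u w : σ → K) :
    (lineRestrict f u w).coeff d = eval w f := by
  rw [lineRestrict, aeval_def, eval₂_eq, eval_eq, Polynomial.finsetSum_coeff]
  refine Finset.sum_congr rfl fun s hs => ?_
  rw [Polynomial.algebraMap_eq, Polynomial.coeff_C_mul,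
    ← (natDegree_le_and_coeff_prod_linear_pow s.support s u w).2, hf.degree_eq_sum_deg_support hs]

end Restriction

/-! ### Linear algebra of lines in the plane -/

section Lines

open Matrix

variable {K : Type*} [Field K]

lemma exists_linearIndependent_of_dotProduct_eq_zero {l u : Fin 3 → K} (hu : u ≠ 0)
    (hlu : l ⬝ᵥ u = 0) : ∃ w, l ⬝ᵥ w = 0 ∧ LinearIndependent K ![u, w] := by
  by_cases hl : l = 0
  · obtain ⟨w, hw⟩ := exists_linearIndependent_pair_of_one_lt_finrank
      (R := K) (M := Fin 3 → K) (by simp) hu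
    exact ⟨w, by simp [hl], hw⟩
  · have h := Module.Dual.finrank_ker_add_one_of_ne_zero
      (f := dotProductBilin K K l) (by
        intro h
        exact hl (dotProduct_eq_zero_iff.mp fun w => by simpa using LinearMap.congr_fun h w))
    rw [Module.finrank_fin_fun] at h
    have hu' : (⟨u, by simpa using hlu⟩ : LinearMap.ker (dotProductBilin K K l)) ≠ 0 := by
      simpa [Subtype.ext_iff] using hu
    obtain ⟨w, hw⟩ := exists_linearIndependent_pair_of_one_lt_finrank (R := K) (by omega) hu'
    refine ⟨w, w.2, LinearIndependent.pair_iff.mpr fun s t hst => ?_⟩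
    exact LinearIndependent.pair_iff.mp hw s t (Subtype.ext hst)

/-- The equation of a line through two distinct points is proportional to their cross product. -/
lemma exists_eq_smul_cross {u w l : Fin 3 → K} (h : LinearIndependent K ![u, w])
    (hu : l ⬝ᵥ u = 0) (hw : l ⬝ᵥ w = 0) : ∃ c : K, l = c • (u ⨯₃ w) := by
  have hn := crossProduct_ne_zero_iff_linearIndependent.mpr h
  have key : ∀ i j, l i * (u ⨯₃ w) j = l j * (u ⨯₃ w) i := by
    simp only [dotProduct, Fin.sum_univ_three] at hu hw
    intro i j
    fin_cases i <;> fin_cases j <;> simp [cross_apply]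
    · linear_combination u 2 * hw - w 2 * hu
    · linear_combination w 1 * hu - u 1 * hw
    · linear_combination w 2 * hu - u 2 * hw
    · linear_combination u 0 * hw - w 0 * hu
    · linear_combination u 1 * hw - w 1 * hu
    · linear_combination w 0 * hu - u 0 * hw
  obtain ⟨j, hj⟩ := Function.ne_iff.mp hn
  refine ⟨l j / (u ⨯₃ w) j, funext fun i => ?_⟩
  rw [Pi.smul_apply, smul_eq_mul, div_mul_eq_mul_div, eq_div_iff hj, key]

lemma exists_eq_smul_of_dotProduct_eq_zero {u w l g : Fin 3 → K}
    (h : LinearIndependent K ![u, w]) (hl : l ≠ 0) (hlu : l ⬝ᵥ u = 0) (hlw : l ⬝ᵥ w = 0)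
    (hgu : g ⬝ᵥ u = 0) (hgw : g ⬝ᵥ w = 0) : ∃ c : K, g = c • l := by
  obtain ⟨a, rfl⟩ := exists_eq_smul_cross h hlu hlw
  obtain ⟨b, rfl⟩ := exists_eq_smul_cross h hgu hgw
  have ha : a ≠ 0 := fun h => hl (by simp [h])
  exact ⟨b / a, by rw [smul_smul, div_mul_cancel₀ _ ha]⟩

/-- Every point of a line is a linear combination of two given distinct points of it. -/
lemma exists_eq_add_of_dotProduct_eq_zero {u w l x : Fin 3 → K}
    (h : LinearIndependent K ![u, w]) (hl : l ≠ 0) (hlu : l ⬝ᵥ u = 0) (hlw : l ⬝ᵥ w = 0)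
    (hlx : l ⬝ᵥ x = 0) : ∃ a b : K, x = a • u + b • w := by
  by_contra hx
  -- otherwise `l` kills three independent vectors
  have h3 : LinearIndependent K ![x, u, w] := by
    refine linearIndependent_finCons.mpr ⟨h, fun hmem => hx ?_⟩
    rw [Matrix.range_cons_cons_empty, Submodule.mem_span_pair] at hmem
    obtain ⟨a, b, hab⟩ := hmem
    exact ⟨a, b, hab.symm⟩
  have hdet : IsUnit (Matrix.of ![x, u, w]) :=
    Matrix.linearIndependent_rows_iff_isUnit.mp h3
  apply hl
  have : (Matrix.of ![x, u, w]) *ᵥ l = 0 := by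
    ext i
    fin_cases i <;> simp [Matrix.mulVec, dotProduct_comm _ l, hlx, hlu, hlw]
  exact Matrix.mulVec_injective_of_isUnit hdet (by rw [this, Matrix.mulVec_zero])

lemma ne_zero_of_linearIndependent_pair {u w : Fin 3 → K} (h : LinearIndependent K ![u, w])
    (t : K) : u + t • w ≠ 0 := fun h0 => by
  simpa using (LinearIndependent.pair_iff.mp h 1 t (by simpa using h0)).1

end Lines

/-! ### Tangency and transversality -/

section Tangency

open Matrix

variable {K : Type*} [Field K]

/-- The gradient of the form `f` at the vector `x`. -/
noncomputable def grad (f : MvPolynomial (Fin 3) K) (x : Fin 3 → K) : Fin 3 → K :=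
  fun i => eval x (pderiv i f)

/-- The line `l · x = 0` is tangent to the curve `f = 0` at the point with homogeneous coordinates
`P`. Singular points of the curve lying on the line count as points of tangency. -/
structure IsTangentAt (f : MvPolynomial (Fin 3) K) (l P : Fin 3 → K) : Prop where
  ne_zero : P ≠ 0
  mem_line : l ⬝ᵥ P = 0
  mem_curve : eval P f = 0
  exists_grad_eq : ∃ c : K, grad f P = c • l

lemma grad_dotProduct (f : MvPolynomial (Fin 3) K) (x w : Fin 3 → K) :
    grad f x ⬝ᵥ w = eval x (dirDeriv w f) := by
  simp [grad, dotProduct, eval_dirDeriv, mul_comm]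

lemma grad_dotProduct_eq_zero_of_line [Infinite K] {f : MvPolynomial (Fin 3) K} {x w : Fin 3 → K}
    (h : ∀ t : K, eval (x + t • w) f = 0) : grad f x ⬝ᵥ w = 0 := by
  have h0 := derivative_lineRestrict f x w
  rw [lineRestrict_eq_zero_iff.mpr h, Polynomial.derivative_zero] at h0
  have := (lineRestrict_eq_zero_iff.mp h0.symm) 0
  rw [grad_dotProduct]
  simpa using this

lemma IsTangentAt.grad_dotProduct_eq_zero {f : MvPolynomial (Fin 3) K} {l P w : Fin 3 → K}
    (h : IsTangentAt f l P) (hw : l ⬝ᵥ w = 0) : grad f P ⬝ᵥ w = 0 := by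
  obtain ⟨c, hc⟩ := h.exists_grad_eq
  rw [hc, smul_dotProduct, hw, smul_zero]

/-- Tangency at a point of the curve only has to be tested in one direction of the line, the other
one being taken care of by Euler's identity. -/
lemma isTangentAt_of_dotProduct {f : MvPolynomial (Fin 3) K} {d : ℕ} (hf : f.IsHomogeneous d)
    {l P w : Fin 3 → K} (hl : l ≠ 0) (hP : l ⬝ᵥ P = 0) (hw : l ⬝ᵥ w = 0)
    (hPw : LinearIndependent K ![P, w]) (hfP : eval P f = 0) (hg : grad f P ⬝ᵥ w = 0) :
    IsTangentAt f l P where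
  ne_zero := by simpa using hPw.ne_zero 0
  mem_line := hP
  mem_curve := hfP
  exists_grad_eq := exists_eq_smul_of_dotProduct_eq_zero hPw hl hP hw
    (by rw [grad_dotProduct, eval_dirDeriv_self hf, hfP, mul_zero]) hg

/-- A line which is nowhere tangent to the curve is not a component of it. -/
lemma exists_eval_ne_zero_of_forall_not_isTangentAt [Infinite K] {f : MvPolynomial (Fin 3) K}
    {d : ℕ} (hf : f.IsHomogeneous d) {l : Fin 3 → K} (hl : l ≠ 0)
    (h : ∀ P, ¬ IsTangentAt f l P) : ∃ u, u ≠ 0 ∧ l ⬝ᵥ u = 0 ∧ eval u f ≠ 0 := by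
  by_contra! H
  have H' : ∀ u, l ⬝ᵥ u = 0 → eval u f = 0 ∨ u = 0 := fun u hu => by
    by_cases hu0 : u = 0
    · exact Or.inr hu0
    · exact Or.inl (H u hu0 hu)
  obtain ⟨u, hu0, hu⟩ : ∃ u, u ≠ 0 ∧ l ⬝ᵥ u = 0 := by
    obtain ⟨w, hw⟩ := exists_linearIndependent_pair_of_one_lt_finrank
      (R := K) (M := Fin 3 → K) (by simp) hl
    exact ⟨l ⨯₃ w, crossProduct_ne_zero_iff_linearIndependent.mpr hw, dot_self_cross l w⟩
  obtain ⟨w, hw, huw⟩ := exists_linearIndependent_of_dotProduct_eq_zero hu0 hu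
  refine h u (isTangentAt_of_dotProduct hf hl hu hw huw (H u hu0 hu)
    (grad_dotProduct_eq_zero_of_line fun t => ?_))
  exact H _ (ne_zero_of_linearIndependent_pair huw t) (by simp [hu, hw])

/-- A line which is nowhere tangent to a curve of degree `d` meets it in exactly `d` points. -/
lemma encard_inter_eq_of_forall_not_isTangentAt [IsAlgClosed K] {f : MvPolynomial (Fin 3) K}
    {d : ℕ} (hf : f.IsHomogeneous d) {l : Fin 3 → K} (hl : l ≠ 0)
    (h : ∀ P, ¬ IsTangentAt f l P) :
    {P : Projectivization K (Fin 3 → K) | eval P.rep f = 0 ∧ l ⬝ᵥ P.rep = 0}.encard = d := by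
  classical
  have : Infinite K := IsAlgClosed.instInfinite
  obtain ⟨u, hu0, hu, hfu⟩ := exists_eval_ne_zero_of_forall_not_isTangentAt hf hl h
  obtain ⟨w, hw, huw⟩ := exists_linearIndependent_of_dotProduct_eq_zero hu0 hu
  have hwu : LinearIndependent K ![w, u] := LinearIndependent.pair_symm_iff.mp huw
  -- the points of the line other than `u` are the `w + t u`, and those on the curve correspond to
  -- the roots of `q`
  set q := lineRestrict f w u with hq
  have hqd : q.coeff d = eval u f := coeff_lineRestrict hf w u
  have hq0 : q ≠ 0 := fun h => hfu (by rw [← hqd, h, Polynomial.coeff_zero])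
  have hdeg : q.natDegree = d := le_antisymm (natDegree_lineRestrict_le hf w u)
    (Polynomial.le_natDegree_of_ne_zero (by rwa [hqd]))
  have hroot : ∀ t : K, eval (w + t • u) f = 0 → grad f (w + t • u) ⬝ᵥ u ≠ 0 := fun t ht hg => by
    refine h _ (isTangentAt_of_dotProduct hf hl (w := u)
      (by rw [dotProduct_add, dotProduct_smul, hw, hu, smul_zero, add_zero]) hu ?_ ht hg)
    rw [LinearIndependent.pair_iff] at hwu ⊢
    intro a b hab
    have := hwu a (a * t + b) (by rw [← hab]; module)
    obtain ⟨rfl, h2⟩ := this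
    exact ⟨rfl, by simpa using h2⟩
  have hnodup : q.roots.Nodup := by
    rw [Multiset.nodup_iff_count_le_one]
    intro t
    rw [Polynomial.count_roots]
    by_contra! hlt
    obtain ⟨h1, h2⟩ := (Polynomial.one_lt_rootMultiplicity_iff_isRoot hq0).mp hlt
    rw [Polynomial.IsRoot, hq, eval_lineRestrict] at h1
    rw [Polynomial.IsRoot, hq, derivative_lineRestrict, eval_lineRestrict, ← grad_dotProduct] at h2
    exact hroot t h1 h2
  have hcard : q.roots.toFinset.card = d := by
    rw [Multiset.toFinset_card_of_nodup hnodup, ← hdeg]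
    exact (IsAlgClosed.splits q).natDegree_eq_card_roots.symm
  have hinj : Function.Injective fun t : K =>
      Projectivization.mk K (w + t • u) (ne_zero_of_linearIndependent_pair hwu t) := by
    intro s t hst
    obtain ⟨a, ha⟩ := (Projectivization.mk_eq_mk_iff' _ _ _ _ _).mp hst
    have := LinearIndependent.pair_iff.mp hwu (a - 1) (a * t - s) (by
      have : a • (w + t • u) - (w + s • u) = 0 := sub_eq_zero.mpr ha
      rw [← this]; module)
    have h1 : a = 1 := sub_eq_zero.mp this.1
    rw [h1] at this
    simpa using (sub_eq_zero.mp this.2).symm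
  have himage : {P : Projectivization K (Fin 3 → K) | eval P.rep f = 0 ∧ l ⬝ᵥ P.rep = 0} =
      (fun t : K => Projectivization.mk K (w + t • u) (ne_zero_of_linearIndependent_pair hwu t)) ''
        (q.roots.toFinset : Set K) := by
    ext P
    have hmem : ∀ t, t ∈ q.roots ↔ eval (w + t • u) f = 0 := fun t => by
      rw [Polynomial.mem_roots hq0, Polynomial.IsRoot, hq, eval_lineRestrict]
    simp only [Set.mem_ofPred_eq, Set.mem_image, Finset.mem_coe, Multiset.mem_toFinset, hmem]
    constructor
    · rintro ⟨hPf, hPl⟩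
      obtain ⟨a, b, hab⟩ := exists_eq_add_of_dotProduct_eq_zero hwu hl hw hu hPl
      have ha : a ≠ 0 := by
        rintro rfl
        have hb : b ≠ 0 := by
          rintro rfl
          exact P.rep_nonzero (by simp [hab])
        rw [hab, zero_smul, zero_add, eval_smul_of_isHomogeneous hf] at hPf
        exact (mul_ne_zero (pow_ne_zero d hb) hfu) hPf
      have hab' : P.rep = a • (w + (b / a) • u) := by
        rw [hab, smul_add, smul_smul, mul_div_cancel₀ _ ha]
      refine ⟨b / a, ?_, ?_⟩
      · rw [hab', eval_smul_of_isHomogeneous hf] at hPf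
        exact (mul_eq_zero.mp hPf).resolve_left (pow_ne_zero d ha)
      · rw [← P.mk_rep, Projectivization.mk_eq_mk_iff']
        exact ⟨a⁻¹, by rw [hab', smul_smul, inv_mul_cancel₀ ha, one_smul]⟩
    · rintro ⟨t, ht, rfl⟩
      obtain ⟨a, ha⟩ := Projectivization.exists_smul_eq_mk_rep K (w + t • u)
        (ne_zero_of_linearIndependent_pair hwu t)
      rw [← ha, Units.smul_def, eval_smul_of_isHomogeneous hf, ht]
      simp [hu, hw]
  rw [himage, hinj.encard_image, Set.encard_coe_eq_coe_finsetCard, hcard]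

/-- A curve of degree at least two containing a line is singular: along a line `l · x = 0` contained
in the curve, the gradient is a multiple of `l`, and the factor is a form of positive degree on the
line, which has a zero. -/
lemma exists_singular_of_line [IsAlgClosed K] {f : MvPolynomial (Fin 3) K}
    {d : ℕ} (hf : f.IsHomogeneous d) (hd : 2 ≤ d) {u w : Fin 3 → K}
    (huw : LinearIndependent K ![u, w]) (h : ∀ t : K, eval (u + t • w) f = 0) :
    ∃ x, x ≠ 0 ∧ eval x f = 0 ∧ grad f x = 0 := by
  have : Infinite K := IsAlgClosed.instInfinite
  have hall : ∀ a b : K, eval (a • u + b • w) f = 0 := by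
    intro a b
    by_cases ha : a = 0
    · rw [ha, zero_smul, zero_add, eval_smul_of_isHomogeneous hf, ← coeff_lineRestrict hf u w,
        lineRestrict_eq_zero_iff.mpr h, Polynomial.coeff_zero, mul_zero]
    · have : a • u + b • w = a • (u + (b / a) • w) := by
        rw [smul_add, smul_smul, mul_div_cancel₀ _ ha]
      rw [this, eval_smul_of_isHomogeneous hf, h, mul_zero]
  have hgrad : ∀ a b : K, ∃ c : K, grad f (a • u + b • w) = c • (u ⨯₃ w) := by
    intro a b
    refine exists_eq_smul_cross huw (grad_dotProduct_eq_zero_of_line fun t => ?_)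
      (grad_dotProduct_eq_zero_of_line fun t => ?_)
    · rw [← hall (a + t) b]; congr 2; module
    · rw [← hall a (b + t)]; congr 2; module
  obtain ⟨i, hi⟩ := Function.ne_iff.mp (crossProduct_ne_zero_iff_linearIndependent.mpr huw)
  -- a zero on the line of the `i`-th partial derivative is a singular point
  suffices H : ∃ a b : K, a • u + b • w ≠ 0 ∧ eval (a • u + b • w) (pderiv i f) = 0 by
    obtain ⟨a, b, h0, hab⟩ := H
    refine ⟨_, h0, hall a b, ?_⟩
    obtain ⟨c, hc⟩ := hgrad a b
    have h1 : c * (u ⨯₃ w) i = 0 := by rw [← hab]; exact (congrFun hc i).symm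
    rw [hc, (mul_eq_zero.mp h1).resolve_right hi, zero_smul]
  by_cases hw : eval w (pderiv i f) = 0
  · exact ⟨0, 1, by simpa using huw.ne_zero 1, by simpa using hw⟩
  · have hcoeff : (lineRestrict (pderiv i f) u w).coeff (d - 1) ≠ 0 := by
      rwa [coeff_lineRestrict hf.pderiv]
    have hdeg := Polynomial.le_natDegree_of_ne_zero hcoeff
    obtain ⟨t, ht⟩ := IsAlgClosed.exists_root (lineRestrict (pderiv i f) u w)
      (fun h => by
        have : _ = 0 := Polynomial.natDegree_eq_of_degree_eq_some h
        omega)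
    rw [Polynomial.IsRoot, eval_lineRestrict] at ht
    exact ⟨1, t, by simpa using ne_zero_of_linearIndependent_pair huw t, by simpa using ht⟩

end Tangency

/-! ### Factors of forms -/

section Factors

variable {σ : Type*} {K : Type*} [Field K]

/-- If `f` and `f * g` are forms, so is `g`: replace it by a suitable homogeneous component. -/
lemma isHomogeneous_right_of_mul {f g : MvPolynomial σ K} {d n : ℕ}
    (hf : f.IsHomogeneous d) (h : (f * g).IsHomogeneous (d + n)) (hf0 : f ≠ 0) :
    g.IsHomogeneous n := by
  classical
  let _ := MvPolynomial.gradedAlgebra (R := K) (σ := σ)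
  have h1 := DirectSum.coe_decompose_mul_add_of_left_mem (homogeneousSubmodule σ K)
    (j := n) (b := g) hf
  have h2 : ∀ (φ : MvPolynomial σ K) i,
    (DirectSum.decompose (homogeneousSubmodule σ K) φ i : MvPolynomial σ K) =
      homogeneousComponent i φ :=
    fun φ i => decomposition.decompose'_apply φ i
  rw [h2, h2, homogeneousComponent_eq_self h] at h1
  rw [mul_left_cancel₀ hf0 h1]
  exact homogeneousComponent_isHomogeneous n g

/-- Factors of forms are forms: the least degree of a monomial and the largest one are both additive
in products. -/
lemma exists_isHomogeneous_of_mul {f g : MvPolynomial σ K} {d : ℕ}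
    (h : (f * g).IsHomogeneous d) (h0 : f * g ≠ 0) :
    ∃ a b, f.IsHomogeneous a ∧ g.IsHomogeneous b ∧ a + b = d := by
  obtain ⟨hf, hg⟩ := mul_ne_zero_iff.mp h0
  have hdeg : ∀ (φ : MvPolynomial σ K) (s : σ →₀ ℕ), coeff s φ ≠ 0 →
      (φ : MvPowerSeries σ K).order ≤ s.degree ∧ s.degree ≤ φ.totalDegree := fun φ s hs =>
    ⟨MvPowerSeries.order_le (by simpa using hs), le_totalDegree (mem_support_iff.mpr hs)⟩
  have hle : ∀ φ : MvPolynomial σ K, φ ≠ 0 → (φ : MvPowerSeries σ K).order ≤ φ.totalDegree := by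
    intro φ hφ
    obtain ⟨s, hs⟩ := ne_zero_iff.mp hφ
    exact (hdeg φ s hs).1.trans (by exact_mod_cast (hdeg φ s hs).2)
  have hord : (d : ℕ∞) ≤ (f : MvPowerSeries σ K).order + (g : MvPowerSeries σ K).order := by
    rw [← MvPowerSeries.order_mul, ← coe_mul]
    refine MvPowerSeries.nat_le_order fun s hs => ?_
    rw [coeff_coe]
    exact h.coeff_eq_zero hs.ne
  have htot : d = f.totalDegree + g.totalDegree := by
    rw [← totalDegree_mul_of_isDomain hf hg, h.totalDegree h0]
  have hf' := hle f hf
  have hg' := hle g hg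
  have hhom : ∀ (φ : MvPolynomial σ K), (φ : MvPowerSeries σ K).order = φ.totalDegree →
      φ.IsHomogeneous φ.totalDegree := by
    intro φ hφ s hs
    have := hdeg φ s hs
    rw [hφ] at this
    change Finsupp.weight (fun _ => 1) s = _
    rw [← Finsupp.degree_eq_weight_one]
    exact le_antisymm this.2 (by exact_mod_cast this.1)
  obtain ⟨m, hm⟩ := ENat.ne_top_iff_exists.mp (ne_top_of_le_ne_top (ENat.natCast_ne_top _) hf')
  obtain ⟨n, hn⟩ := ENat.ne_top_iff_exists.mp (ne_top_of_le_ne_top (ENat.natCast_ne_top _) hg')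
  rw [← hm] at hf'
  rw [← hn] at hg'
  rw [← hm, ← hn] at hord
  norm_cast at hf' hg' hord
  refine ⟨_, _, hhom f ?_, hhom g ?_, htot.symm⟩
  · rw [← hm]; norm_cast; omega
  · rw [← hn]; norm_cast; omega

end Factors

/-! ### Irreducibility of smooth curves -/

section CommonZero

variable {K : Type*} [Field K] [IsAlgClosed K]

/-- Two plane curves have a common point: otherwise their affine cones would only meet in the
origin, whereas by Krull's height theorem the maximal ideal of a point, which has height three,
is not minimal over an ideal with two generators. -/
lemma exists_common_zero {f g : MvPolynomial (Fin 3) K} {a b : ℕ} (hf : f.IsHomogeneous a)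
    (hg : g.IsHomogeneous b) (ha : a ≠ 0) (hb : b ≠ 0) :
    ∃ x, x ≠ 0 ∧ eval x f = 0 ∧ eval x g = 0 := by
  by_contra! H
  have hdim : ringKrullDim (MvPolynomial (Fin 3) K) = 3 := by
    rw [MvPolynomial.ringKrullDim_of_isNoetherianRing, ringKrullDim_eq_zero_of_field]; simp
  have : FiniteRingKrullDim (MvPolynomial (Fin 3) K) := by
    rw [finiteRingKrullDim_iff_ne_bot_and_top, hdim]
    exact ⟨by decide, by decide⟩
  obtain ⟨M, hM, hht⟩ := Ideal.exists_isMaximal_height (R := MvPolynomial (Fin 3) K)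
  obtain ⟨y, hy⟩ := isMaximal_iff_eq_vanishingIdeal_singleton.mp hM
  -- move the origin, the only common zero of `f` and `g` in affine space, to the point `y`
  set τ : MvPolynomial (Fin 3) K →ₐ[K] MvPolynomial (Fin 3) K := aeval fun i => X i - C (y i)
  have hτ : ∀ φ x, eval x (τ φ) = eval (x - y) φ := by
    intro φ x
    rw [← aeval_eq_eval, ← aeval_eq_eval, ← AlgHom.comp_apply]
    congr 1
    ext i
    simp [τ]
  have hzero : zeroLocus K (Ideal.span {τ f, τ g}) = {y} := by
    rw [zeroLocus_span]
    ext x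
    have h0 : ∀ φ : MvPolynomial (Fin 3) K, ∀ n, φ.IsHomogeneous n → n ≠ 0 → eval 0 φ = 0 := by
      intro φ n hφ hn
      have := eval_smul_of_isHomogeneous hφ 0 0
      rwa [smul_zero, zero_pow hn, zero_mul] at this
    simp only [Set.mem_insert_iff, Set.mem_singleton_iff, forall_eq_or_imp, forall_eq,
      Set.mem_ofPred_eq, aeval_eq_eval, hτ]
    constructor
    · rintro ⟨h1, h2⟩
      by_contra hxy
      exact H (x - y) (sub_ne_zero.mpr hxy) h1 h2
    · rintro rfl
      rw [sub_self]
      exact ⟨h0 f a hf ha, h0 g b hg hb⟩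
  have hrad : (Ideal.span {τ f, τ g}).radical = M := by
    rw [← vanishingIdeal_zeroLocus_eq_radical (K := K), hzero, hy]
  have hmin : M ∈ (Ideal.span {τ f, τ g}).minimalPrimes := by
    refine ⟨⟨hM.isPrime, hrad ▸ Ideal.le_radical⟩, fun J hJ _ => ?_⟩
    rw [← hrad]
    exact hJ.1.radical_le_iff.mpr hJ.2
  have hle := Ideal.height_le_card_of_mem_minimalPrimes_span (Set.toFinite _) hmin
  have hcard : ({τ f, τ g} : Set (MvPolynomial (Fin 3) K)).ncard ≤ 2 := by
    simpa using Set.ncard_insert_le (τ f) {τ g}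
  have h2 : M.height ≤ 2 := hle.trans (by exact_mod_cast hcard)
  rw [hdim] at hht
  have h3 : M.height = 3 := WithBot.coe_injective hht
  rw [h3] at h2
  exact absurd h2 (by decide)

/-- A smooth plane curve is irreducible, since two components would meet in a singular point. -/
lemma irreducible_of_forall_grad_ne_zero {f : MvPolynomial (Fin 3) K} {d : ℕ}
    (hf : f.IsHomogeneous d) (hd : d ≠ 0) (hf0 : f ≠ 0)
    (hs : ∀ x, x ≠ 0 → eval x f = 0 → grad f x ≠ 0) : Irreducible f := by
  have hunit : ∀ φ : MvPolynomial (Fin 3) K, φ ≠ 0 → φ.IsHomogeneous 0 → IsUnit φ := by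
    intro φ h0 h
    rw [← totalDegree_zero_iff_isHomogeneous, totalDegree_eq_zero_iff_eq_C] at h
    rw [h] at h0 ⊢
    exact (IsUnit.mk0 _ (fun h => h0 (by rw [h, C_0]))).map C
  refine ⟨fun hu => ?_, fun A B hAB => ?_⟩
  · have := (MvPolynomial.isUnit_iff_totalDegree_of_isReduced.mp hu).2
    exact hd (by rw [← hf.totalDegree hf0, this])
  · by_contra! hn
    rw [hAB] at hf hf0
    obtain ⟨a, b, hA, hB, -⟩ := exists_isHomogeneous_of_mul hf hf0
    have ha : a ≠ 0 := by
      rintro rfl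
      exact hn.1 (hunit A (left_ne_zero_of_mul hf0) hA)
    have hb : b ≠ 0 := by
      rintro rfl
      exact hn.2 (hunit B (right_ne_zero_of_mul hf0) hB)
    obtain ⟨x, hx, h1, h2⟩ := exists_common_zero hA hB ha hb
    refine hs x hx (by rw [hAB, map_mul, h1, zero_mul]) (funext fun i => ?_)
    simp [grad, hAB, h1, h2]

end CommonZero

/-! ### Bézout's inequality with tangency conditions -/

section Interpolation

open Matrix

variable {K : Type*} [Field K]

/-- The linear form with coefficient vector `a`. -/
noncomputable def linForm (a : Fin 3 → K) : MvPolynomial (Fin 3) K := ∑ i, C (a i) * X i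

lemma isHomogeneous_linForm (a : Fin 3 → K) : (linForm a).IsHomogeneous 1 :=
  IsHomogeneous.sum _ _ _ fun _ _ => isHomogeneous_C_mul_X _ _

lemma eval_linForm (a x : Fin 3 → K) : eval x (linForm a) = a ⬝ᵥ x := by
  simp [linForm, dotProduct]

lemma eval_dirDeriv_linForm (a v x : Fin 3 → K) : eval x (dirDeriv v (linForm a)) = a ⬝ᵥ v := by
  classical
  rw [eval_dirDeriv]
  simp [linForm, dotProduct, pderiv_X, Pi.single_apply, mul_comm]

lemma eval_dirDeriv_mul (v x : Fin 3 → K) (f g : MvPolynomial (Fin 3) K) :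
    eval x (dirDeriv v (f * g)) =
      eval x (dirDeriv v f) * eval x g + eval x f * eval x (dirDeriv v g) := by
  rw [dirDeriv_mul]; simp

lemma exists_dotProduct_ne_zero {x : Fin 3 → K} (hx : x ≠ 0) : ∃ a : Fin 3 → K, a ⬝ᵥ x ≠ 0 := by
  obtain ⟨i, hi⟩ := Function.ne_iff.mp hx
  exact ⟨Pi.single i 1, by simpa using hi⟩

lemma exists_dotProduct_eq_zero_and_ne_zero {x y : Fin 3 → K} (h : LinearIndependent K ![x, y]) :
    ∃ a : Fin 3 → K, a ⬝ᵥ x = 0 ∧ a ⬝ᵥ y ≠ 0 := by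
  obtain ⟨k, hk⟩ := Function.ne_iff.mp (crossProduct_ne_zero_iff_linearIndependent.mpr h)
  refine ⟨Pi.single k 1 ⨯₃ x, by rw [dotProduct_comm, dot_cross_self], ?_⟩
  rw [dotProduct_comm, triple_product_permutation]
  simpa using hk

variable {ι : Type*} [Fintype ι] {P : ι → Fin 3 → K}

/-- For pairwise distinct points there are forms of the same degree, each of which vanishes to
second order at all the points but one: take products of squares of linear forms. -/
lemma exists_separating_forms (hP : ∀ i j, i ≠ j → LinearIndependent K ![P i, P j])
    (v : ι → Fin 3 → K) : ∃ N : ℕ, ∀ i, ∃ U : MvPolynomial (Fin 3) K, U.IsHomogeneous N ∧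
      eval (P i) U ≠ 0 ∧ ∀ j, j ≠ i → eval (P j) U = 0 ∧ eval (P j) (dirDeriv (v j) U) = 0 := by
  classical
  have hm : ∀ i j, ∃ a : Fin 3 → K, i ≠ j → a ⬝ᵥ P j = 0 ∧ a ⬝ᵥ P i ≠ 0 := fun i j => by
    by_cases hij : i = j
    · exact ⟨0, fun h => absurd hij h⟩
    · obtain ⟨a, ha⟩ := exists_dotProduct_eq_zero_and_ne_zero (hP j i (Ne.symm hij))
      exact ⟨a, fun _ => ha⟩
  choose a ha using hm
  refine ⟨(Fintype.card ι - 1) * 2, fun i =>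
    ⟨∏ j ∈ Finset.univ.erase i, linForm (a i j) ^ 2, ?_, ?_, fun j hj => ?_⟩⟩
  · have := IsHomogeneous.prod (Finset.univ.erase i) (fun j => linForm (a i j) ^ 2) (fun _ => 2)
      (fun j _ => by simpa using (isHomogeneous_linForm (a i j)).pow 2)
    simpa using this
  · rw [map_prod, Finset.prod_ne_zero_iff]
    intro j hj
    rw [map_pow, eval_linForm]
    exact pow_ne_zero 2 (ha i j (Finset.ne_of_mem_erase hj).symm).2
  · rw [← Finset.mul_prod_erase _ _ (Finset.mem_erase.mpr ⟨hj, Finset.mem_univ j⟩), sq]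
    simp [eval_dirDeriv_mul, eval_linForm, (ha i j hj.symm).1]

/-- Forms of large degree with prescribed values at the points `P i`, and with prescribed
derivatives in the directions `v i` at some of these points. -/
lemma exists_form_interpolating (hP0 : ∀ i, P i ≠ 0)
    (hP : ∀ i j, i ≠ j → LinearIndependent K ![P i, P j])
    (v : ι → Fin 3 → K) (T : Finset ι) (hT : ∀ i ∈ T, LinearIndependent K ![P i, v i]) :
    ∃ N : ℕ, ∀ m : ℕ, ∀ a b : ι → K, ∃ F : MvPolynomial (Fin 3) K, F.IsHomogeneous (N + 1 + m) ∧
      (∀ i, eval (P i) F = a i) ∧ ∀ i ∈ T, eval (P i) (dirDeriv (v i) F) = b i := by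
  classical
  obtain ⟨N, hN⟩ := exists_separating_forms hP v
  choose U hU hUi hUj using hN
  choose h hh using fun i => exists_dotProduct_ne_zero (hP0 i)
  have hs : ∀ i, ∃ s : Fin 3 → K, i ∈ T → s ⬝ᵥ P i = 0 ∧ s ⬝ᵥ v i ≠ 0 := fun i => by
    by_cases hi : i ∈ T
    · obtain ⟨s, hs⟩ := exists_dotProduct_eq_zero_and_ne_zero (hT i hi)
      exact ⟨s, fun _ => hs⟩
    · exact ⟨0, fun h => absurd h hi⟩
  choose s hs using hs
  refine ⟨N, fun m a b => ?_⟩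
  -- `W i` has value one at `P i`, `V i` has derivative one in the direction `v i`
  set W : ι → MvPolynomial (Fin 3) K := fun i =>
    C ((eval (P i) (U i) * (h i ⬝ᵥ P i) ^ (m + 1))⁻¹) * (U i * linForm (h i) ^ (m + 1)) with hW
  set V : ι → MvPolynomial (Fin 3) K := fun i =>
    C ((eval (P i) (U i) * (h i ⬝ᵥ P i) ^ m * (s i ⬝ᵥ v i))⁻¹) *
      (U i * linForm (h i) ^ m * linForm (s i)) with hV
  have hWhom : ∀ i, (W i).IsHomogeneous (N + 1 + m) := fun i => by
    have := ((hU i).mul ((isHomogeneous_linForm (h i)).pow (m + 1))).C_mul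
      (eval (P i) (U i) * (h i ⬝ᵥ P i) ^ (m + 1))⁻¹
    convert this using 1; ring
  have hVhom : ∀ i, (V i).IsHomogeneous (N + 1 + m) := fun i => by
    have := (((hU i).mul ((isHomogeneous_linForm (h i)).pow m)).mul
      (isHomogeneous_linForm (s i))).C_mul
      (eval (P i) (U i) * (h i ⬝ᵥ P i) ^ m * (s i ⬝ᵥ v i))⁻¹
    convert this using 1; ring
  have hWi : ∀ i j, eval (P j) (W i) = if i = j then 1 else 0 := fun i j => by
    split_ifs with hij
    · subst hij
      simp only [hW, map_mul, eval_C, map_pow, eval_linForm]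
      exact inv_mul_cancel₀ (mul_ne_zero (hUi i) (pow_ne_zero _ (hh i)))
    · simp [hW, (hUj i j (Ne.symm hij)).1]
  have hVi : ∀ i ∈ T, ∀ j, eval (P j) (V i) = 0 := fun i hi j => by
    by_cases hij : j = i
    · subst hij
      simp [hV, eval_linForm, (hs j hi).1]
    · simp [hV, (hUj i j hij).1]
  have hVd : ∀ i ∈ T, ∀ j, eval (P j) (dirDeriv (v j) (V i)) = if i = j then 1 else 0 := by
    intro i hi j
    split_ifs with hij
    · subst hij
      simp only [hV, eval_dirDeriv_mul, dirDeriv_C, map_mul, eval_C, map_pow, eval_linForm,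
        eval_dirDeriv_linForm, (hs i hi).1]
      simp only [mul_zero, zero_add]
      exact inv_mul_cancel₀ (mul_ne_zero (mul_ne_zero (hUi i) (pow_ne_zero _ (hh i))) (hs i hi).2)
    · simp [hV, eval_dirDeriv_mul, dirDeriv_C, (hUj i j (Ne.symm hij)).1,
        (hUj i j (Ne.symm hij)).2]
  have hd_sum : ∀ (S : Finset ι) (w x : Fin 3 → K) (c : ι → K) (G : ι → MvPolynomial (Fin 3) K),
      eval x (dirDeriv w (∑ i ∈ S, C (c i) * G i)) =
        ∑ i ∈ S, c i * eval x (dirDeriv w (G i)) := by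
    intro S w x c G
    induction S using Finset.induction_on with
    | empty => simp [dirDeriv]
    | insert i S hi ih =>
      rw [Finset.sum_insert hi, Finset.sum_insert hi, dirDeriv_add, map_add, ih, eval_dirDeriv_mul,
        dirDeriv_C]
      simp
  obtain ⟨F₀, hF₀⟩ : ∃ F₀, F₀ = ∑ i, C (a i) * W i := ⟨_, rfl⟩
  refine ⟨F₀ + ∑ i ∈ T, C (b i - eval (P i) (dirDeriv (v i) F₀)) * V i, ?_, fun j => ?_,
    fun j hj => ?_⟩
  · rw [hF₀]
    exact (IsHomogeneous.sum _ _ _ fun i _ => (hWhom i).C_mul _).add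
      (IsHomogeneous.sum _ _ _ fun i _ => (hVhom i).C_mul _)
  · have h1 : eval (P j) F₀ = a j := by simp [hF₀, hWi]
    have h2 : eval (P j) (∑ i ∈ T, C (b i - eval (P i) (dirDeriv (v i) F₀)) * V i) = 0 := by
      rw [map_sum]
      exact Finset.sum_eq_zero fun i hi => by rw [map_mul, hVi i hi, mul_zero]
    rw [map_add, h1, h2, add_zero]
  · have h3 : ∑ i ∈ T, (b i - eval (P i) (dirDeriv (v i) F₀)) * eval (P j) (dirDeriv (v j) (V i)) =
        ∑ i ∈ T, (b i - eval (P i) (dirDeriv (v i) F₀)) * if i = j then 1 else 0 :=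
      Finset.sum_congr rfl fun i hi => by rw [hVd i hi j]
    rw [dirDeriv_add, map_add, hd_sum, h3]
    simp [hj]

end Interpolation

section Bezout

variable {K : Type*} [Field K]

instance finiteDimensional_homogeneousSubmodule (n : ℕ) :
    FiniteDimensional K (homogeneousSubmodule (Fin 3) K n) :=
  Module.Finite.iff_fg.mpr (homogeneousSubmodule_fg (Fin 3) K n)

lemma finrank_homogeneousSubmodule (n : ℕ) :
    Module.finrank K (homogeneousSubmodule (Fin 3) K n) = (n + 2).choose 2 := by
  have h1 : homogeneousSubmodule (Fin 3) K n = Submodule.span K (Set.range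
      fun s : (Finset.univ : Finset (Fin 3)).finsuppAntidiag n =>
        monomial (s : Fin 3 →₀ ℕ) (1 : K)) := by
    rw [homogeneousSubmodule_eq_finsupp_supported, AddMonoidAlgebra.supported_eq_span_single]
    refine congrArg _ (Set.ext fun q => ?_)
    simp [Finset.mem_finsuppAntidiag, Finsupp.degree_eq_sum, single_eq_monomial]
  have hli := (basisMonomials (Fin 3) K).linearIndependent.comp
    (fun s : (Finset.univ : Finset (Fin 3)).finsuppAntidiag n => (s : Fin 3 →₀ ℕ))
    Subtype.val_injective
  rw [coe_basisMonomials] at hli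
  have h2 := finrank_span_eq_card hli
  rw [h1]
  refine Eq.trans h2 ?_
  rw [Fintype.card_coe, Finset.card_finsuppAntidiag_nat_eq_choose, Finset.card_univ,
    Fintype.card_fin, show 3 + n - 1 = n + 2 by omega]
  exact Nat.choose_symm_add

/-- The degree `c + d + e` part of the ideal of two curves of degrees `d` and `e` without common
component has codimension at most `d * e`. -/
lemma finrank_le_finrank_sup_add {f g : MvPolynomial (Fin 3) K} {d e : ℕ}
    (hf : f.IsHomogeneous d) (hfp : Prime f) (hfg : ¬ f ∣ g) (c : ℕ) :
    Module.finrank K (homogeneousSubmodule (Fin 3) K (c + d + e)) ≤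
      Module.finrank K
        ((homogeneousSubmodule (Fin 3) K (c + e)).map (LinearMap.mulLeft K f) ⊔
          (homogeneousSubmodule (Fin 3) K (c + d)).map (LinearMap.mulLeft K g) :
            Submodule K (MvPolynomial (Fin 3) K)) + d * e := by
  have hg0 : g ≠ 0 := fun h => hfg (h ▸ dvd_zero f)
  have hinj : ∀ h : MvPolynomial (Fin 3) K, h ≠ 0 → ∀ n,
      Module.finrank K ((homogeneousSubmodule (Fin 3) K n).map (LinearMap.mulLeft K h)) =
        (n + 2).choose 2 := by
    intro h hh n
    have hi : Function.Injective (LinearMap.mulLeft K h) := fun x y hxy => mul_left_cancel₀ hh hxy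
    rw [← (Submodule.equivMapOfInjective _ hi _).finrank_eq, finrank_homogeneousSubmodule]
  -- a relation `f A = g B` forces `f ∣ B`
  have hinf : (homogeneousSubmodule (Fin 3) K (c + e)).map (LinearMap.mulLeft K f) ⊓
      (homogeneousSubmodule (Fin 3) K (c + d)).map (LinearMap.mulLeft K g) ≤
      (homogeneousSubmodule (Fin 3) K c).map (LinearMap.mulLeft K (g * f)) := by
    rintro _ ⟨⟨A, hA, rfl⟩, ⟨B, hB, hAB⟩⟩
    simp only [LinearMap.mulLeft_apply] at hAB ⊢
    obtain ⟨q, rfl⟩ := (hfp.dvd_or_dvd (hAB ▸ dvd_mul_right f A : f ∣ g * B)).resolve_left hfg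
    refine ⟨q, isHomogeneous_right_of_mul hf (add_comm c d ▸ hB) hfp.ne_zero, ?_⟩
    rw [LinearMap.mulLeft_apply, ← hAB, mul_assoc]
  have h1 := Submodule.finrank_mono hinf
  have h2 := Submodule.finrank_sup_add_finrank_inf_eq
    ((homogeneousSubmodule (Fin 3) K (c + e)).map (LinearMap.mulLeft K f))
    ((homogeneousSubmodule (Fin 3) K (c + d)).map (LinearMap.mulLeft K g))
  rw [hinj _ (mul_ne_zero hg0 hfp.ne_zero)] at h1
  rw [hinj _ hfp.ne_zero, hinj _ hg0] at h2
  rw [finrank_homogeneousSubmodule]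
  have hch : ∀ x : ℕ, 2 * (x + 2).choose 2 = (x + 2) * (x + 1) := fun x => by
    rw [Nat.choose_two_right, Nat.mul_div_cancel' (Nat.even_mul_pred_self _).two_dvd]
    rfl
  have e1 := hch (c + d + e)
  have e2 := hch (c + e)
  have e3 := hch (c + d)
  have e4 := hch c
  have e5 : (c + d + e + 2) * (c + d + e + 1) + (c + 2) * (c + 1) =
    (c + e + 2) * (c + e + 1) + (c + d + 2) * (c + d + 1) + 2 * (d * e) := by ring
  omega

/-- The values of a form at the points `P i`, and its derivatives in the directions `v i` at those
points `P i` with `i ∈ T`. -/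
noncomputable def jetMap {ι : Type*} (P v : ι → Fin 3 → K) (T : Finset ι) :
    MvPolynomial (Fin 3) K →ₗ[K] (ι → K) × (T → K) where
  toFun F := (fun i => eval (P i) F, fun i => eval (P i) (dirDeriv (v i) F))
  map_add' F G := by ext <;> simp [dirDeriv_add]
  map_smul' c F := by ext <;> simp [smul_eq_C_mul, dirDeriv_mul, dirDeriv_C]

lemma jetMap_apply {ι : Type*} (P v : ι → Fin 3 → K) (T : Finset ι) (F : MvPolynomial (Fin 3) K) :
    jetMap P v T F =
      (fun i => eval (P i) F, fun i : T => eval (P i) (dirDeriv (v i) F)) := rfl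

lemma jetMap_mul_eq_zero {ι : Type*} {P v : ι → Fin 3 → K} {T : Finset ι}
    {h : MvPolynomial (Fin 3) K} (h1 : ∀ i, eval (P i) h = 0)
    (h2 : ∀ i ∈ T, eval (P i) (dirDeriv (v i) h) = 0) (A : MvPolynomial (Fin 3) K) :
    jetMap P v T (h * A) = 0 := by
  refine Prod.ext (funext fun i => ?_) (funext fun i => ?_)
  · simp [jetMap, h1]
  · simp [jetMap, eval_dirDeriv_mul, h1, h2 i i.2]

/-- Bézout's inequality: two curves of degrees `d` and `e` without common component meet in at most
`d * e` points, where those points of intersection count twice at which both curves have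
a common tangent direction. The reason is that the values and the derivatives in question are
linearly independent functionals on the forms of large degree, and vanish on the ideal of the two
curves. -/
theorem card_add_card_le_mul {f g : MvPolynomial (Fin 3) K} {d e : ℕ}
    (hf : f.IsHomogeneous d) (hg : g.IsHomogeneous e) (hfp : Prime f) (hfg : ¬ f ∣ g)
    {ι : Type*} [Fintype ι] (P : ι → Fin 3 → K) (hP0 : ∀ i, P i ≠ 0)
    (hP : ∀ i j, i ≠ j → LinearIndependent K ![P i, P j])
    (hPf : ∀ i, eval (P i) f = 0) (hPg : ∀ i, eval (P i) g = 0)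
    (v : ι → Fin 3 → K) (T : Finset ι) (hT : ∀ i ∈ T, LinearIndependent K ![P i, v i])
    (hTf : ∀ i ∈ T, eval (P i) (dirDeriv (v i) f) = 0)
    (hTg : ∀ i ∈ T, eval (P i) (dirDeriv (v i) g) = 0) :
    Fintype.card ι + T.card ≤ d * e := by
  classical
  obtain ⟨N, hN⟩ := exists_form_interpolating hP0 hP v T hT
  have hn : N + 1 + d + e = N + 1 + (d + e) := by ring
  have hle := finrank_le_finrank_sup_add (e := e) hf hfp hfg (N + 1)
  obtain ⟨I, hI⟩ : ∃ I, I =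
    (homogeneousSubmodule (Fin 3) K (N + 1 + e)).map (LinearMap.mulLeft K f) ⊔
    (homogeneousSubmodule (Fin 3) K (N + 1 + d)).map (LinearMap.mulLeft K g) := ⟨_, rfl⟩
  rw [← hI] at hle
  obtain ⟨S, hS⟩ : ∃ S, S = homogeneousSubmodule (Fin 3) K (N + 1 + d + e) := ⟨_, rfl⟩
  have hfin : FiniteDimensional K S := hS ▸ inferInstance
  rw [← hS] at hle
  have hIS : I ≤ S := by
    rw [hI, sup_le_iff]
    constructor
    · rintro _ ⟨A, hA, rfl⟩
      have := hf.mul hA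
      rw [hS, mem_homogeneousSubmodule, LinearMap.mulLeft_apply]
      convert this using 1; ring
    · rintro _ ⟨A, hA, rfl⟩
      have := hg.mul hA
      rw [hS, mem_homogeneousSubmodule, LinearMap.mulLeft_apply]
      convert this using 1; ring
  have hJI : I ≤ LinearMap.ker (jetMap P v T) := by
    rw [hI, sup_le_iff]
    constructor
    · rintro _ ⟨A, -, rfl⟩
      exact jetMap_mul_eq_zero hPf hTf A
    · rintro _ ⟨A, -, rfl⟩
      exact jetMap_mul_eq_zero hPg hTg A
  have hsurj : LinearMap.range ((jetMap P v T).domRestrict S) = ⊤ := by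
    rw [LinearMap.range_eq_top]
    rintro ⟨a, b⟩
    obtain ⟨F, hF, h1, h2⟩ := hN (d + e) a (fun i => if h : i ∈ T then b ⟨i, h⟩ else 0)
    have hFS : F ∈ S := by rw [hS, mem_homogeneousSubmodule, hn]; exact hF
    refine ⟨⟨F, hFS⟩, ?_⟩
    rw [LinearMap.domRestrict_apply, jetMap_apply]
    refine Prod.mk_inj.mpr ⟨funext h1, funext fun i => ?_⟩
    have h3 := h2 i i.2
    rw [dif_pos i.2] at h3
    exact h3
  have hrank := LinearMap.finrank_range_add_finrank_ker ((jetMap P v T).domRestrict S)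
  have hker : Module.finrank K I ≤
      Module.finrank K (LinearMap.ker ((jetMap P v T).domRestrict S)) := by
    rw [← (Submodule.comapSubtypeEquivOfLe hIS).finrank_eq]
    exact Submodule.finrank_mono fun x hx => hJI hx
  rw [hsurj, finrank_top, Module.finrank_prod, Module.finrank_fintype_fun_eq_card,
    Module.finrank_fintype_fun_eq_card, Fintype.card_coe] at hrank
  omega

end Bezout

/-! ### The Frobenius and rational tangent lines -/

section Tangents

open Matrix

variable {K : Type*} [Field K] {f : MvPolynomial (Fin 3) K} {d : ℕ}

lemma grad_smul (hf : f.IsHomogeneous d) (c : K) (x : Fin 3 → K) :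
    grad f (c • x) = c ^ (d - 1) • grad f x :=
  funext fun _ => eval_smul_of_isHomogeneous hf.pderiv c x

lemma IsTangentAt.smul (hf : f.IsHomogeneous d) {l P : Fin 3 → K} (h : IsTangentAt f l P) {c : K}
    (hc : c ≠ 0) : IsTangentAt f l (c • P) where
  ne_zero := smul_ne_zero hc h.ne_zero
  mem_line := by rw [dotProduct_smul, h.mem_line, smul_zero]
  mem_curve := by rw [eval_smul_of_isHomogeneous hf, h.mem_curve, mul_zero]
  exists_grad_eq := by
    obtain ⟨a, ha⟩ := h.exists_grad_eq
    exact ⟨c ^ (d - 1) * a, by rw [grad_smul hf, ha, smul_smul]⟩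

lemma exists_eq_smul_of_not_linearIndependent {P Q : Fin 3 → K} (hP : P ≠ 0) (hQ : Q ≠ 0)
    (h : ¬ LinearIndependent K ![P, Q]) : ∃ c : K, c ≠ 0 ∧ Q = c • P := by
  rw [LinearIndependent.pair_iff' hP] at h
  push Not at h
  obtain ⟨c, rfl⟩ := h
  exact ⟨c, fun h => hQ (by rw [h, zero_smul]), rfl⟩

/-- A smooth curve has only one tangent line at each of its points. -/
lemma linearIndependent_of_isTangentAt (hf : f.IsHomogeneous d)
    (hs : ∀ x, x ≠ 0 → eval x f = 0 → grad f x ≠ 0) {l m P Q : Fin 3 → K}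
    (hlm : LinearIndependent K ![l, m]) (hP : IsTangentAt f l P) (hQ : IsTangentAt f m Q) :
    LinearIndependent K ![P, Q] := by
  by_contra h
  obtain ⟨c, hc, rfl⟩ := exists_eq_smul_of_not_linearIndependent hP.ne_zero hQ.ne_zero h
  obtain ⟨a, ha⟩ := (hP.smul hf hc).exists_grad_eq
  obtain ⟨b, hb⟩ := hQ.exists_grad_eq
  refine hs _ hQ.ne_zero hQ.mem_curve ?_
  have := (LinearIndependent.pair_iff.mp hlm a (-b) (by rw [← ha, hb]; module)).1
  rw [ha, this, zero_smul]

lemma pderiv_comm (i j : Fin 3) (f : MvPolynomial (Fin 3) K) :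
    pderiv i (pderiv j f) = pderiv j (pderiv i f) := by
  have h : ⁅pderiv (R := K) i, pderiv (R := K) j⁆ = 0 := by
    classical
    refine derivation_ext fun k => ?_
    simp [Derivation.commutator_apply, pderiv_X, Pi.single_apply, apply_ite]
  have := DFunLike.congr_fun h f
  rwa [Derivation.commutator_apply, Derivation.zero_apply, sub_eq_zero] at this

/-- Besides the top coefficient of the restriction of a form of degree `d` to the line
`t ↦ u + t w`, the coefficient of degree `d - 1` is also determined by the behaviour of the form
at the point at infinity `w`. -/
lemma coeff_pred_lineRestrict [Infinite K] (hf : f.IsHomogeneous d) (hd : 1 ≤ d)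
    (u w : Fin 3 → K) : (lineRestrict f u w).coeff (d - 1) = grad f w ⬝ᵥ u := by
  -- Euler's identity along the line
  have h : lineRestrict (dirDeriv u f) u w +
      Polynomial.X * Polynomial.derivative (lineRestrict f u w) =
      Polynomial.C (d : K) * lineRestrict f u w := by
    refine Polynomial.funext fun t => ?_
    have := eval_dirDeriv_self hf (u + t • w)
    rw [derivative_lineRestrict]
    simp only [Polynomial.eval_add, Polynomial.eval_mul, Polynomial.eval_X, Polynomial.eval_C,
      eval_lineRestrict]
    rw [← this, ← grad_dotProduct, ← grad_dotProduct, ← grad_dotProduct, dotProduct_add,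
      dotProduct_smul, smul_eq_mul]
  have hX : ∀ (q : Polynomial K) (n : ℕ),
      (Polynomial.X * Polynomial.derivative q).coeff n = n * q.coeff n := by
    intro q n
    cases n with
    | zero => simp
    | succ n => rw [Polynomial.coeff_X_mul, Polynomial.coeff_derivative]; push_cast; ring
  have h1 := congrArg (fun q => Polynomial.coeff q (d - 1)) h
  simp only [Polynomial.coeff_add, Polynomial.coeff_C_mul, hX] at h1
  rw [coeff_lineRestrict (isHomogeneous_dirDeriv hf u), ← grad_dotProduct] at h1
  rw [Nat.cast_sub hd, Nat.cast_one] at h1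
  linear_combination -h1

/-- In characteristic `p`, a solution of `q' ≡ q g` modulo `X ^ p` with `q(0) = 0` vanishes modulo
`X ^ p`. -/
lemma coeff_eq_zero_of_derivative_eq {p : ℕ} [Fact p.Prime] [CharP K p] {q r g : Polynomial K}
    (h0 : q.coeff 0 = 0) (h : Polynomial.derivative q + Polynomial.X ^ p * r = q * g) :
    ∀ m < p, q.coeff m = 0 := by
  intro m
  induction m using Nat.strong_induction_on with
  | _ m ih =>
    intro hm
    obtain _ | k := m
    · exact h0
    have h1 := congrArg (fun q => Polynomial.coeff q k) h
    simp only [Polynomial.coeff_add, Polynomial.coeff_derivative, Polynomial.coeff_X_pow_mul',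
      if_neg (show ¬ p ≤ k by omega), add_zero] at h1
    rw [Polynomial.coeff_mul, Finset.sum_eq_zero] at h1
    · refine (mul_eq_zero.mp h1).resolve_right fun h => ?_
      have h2 : ((k + 1 : ℕ) : K) = 0 := by exact_mod_cast h
      exact absurd (Nat.le_of_dvd k.succ_pos ((CharP.cast_eq_zero_iff K p _).mp h2)) (by omega)
    · intro x hx
      have := Finset.HasAntidiagonal.mem_antidiagonal.mp hx
      rw [ih x.1 (by omega) (by omega), zero_mul]

end Tangents

section Frobenius

open Matrix

variable {K : Type*} [Field K] {p : ℕ}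

variable (p) in
/-- The Frobenius of the plane, raising coordinates to the `p`-th power. -/
def frob (x : Fin 3 → K) : Fin 3 → K := fun i => x i ^ p

variable (p) in
/-- The form `∑ xⱼᵖ ∂ⱼ f`. It vanishes at those points of the curve `f = 0` where the tangent line
passes through the image of the point under the Frobenius. -/
noncomputable def frobPolar (f : MvPolynomial (Fin 3) K) : MvPolynomial (Fin 3) K :=
  ∑ j, X j ^ p * pderiv j f

lemma isHomogeneous_frobPolar {f : MvPolynomial (Fin 3) K} {d : ℕ} (hf : f.IsHomogeneous d) :
    (frobPolar p f).IsHomogeneous (p + (d - 1)) :=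
  IsHomogeneous.sum _ _ _ fun j _ => (isHomogeneous_X_pow j p).mul hf.pderiv

lemma eval_frobPolar (f : MvPolynomial (Fin 3) K) (x : Fin 3 → K) :
    eval x (frobPolar p f) = grad f x ⬝ᵥ frob p x := by
  simp [frobPolar, grad, frob, dotProduct, mul_comm]

lemma frob_ne_zero {x : Fin 3 → K} (hx : x ≠ 0) : frob p x ≠ 0 := by
  obtain ⟨i, hi⟩ := Function.ne_iff.mp hx
  exact Function.ne_iff.mpr ⟨i, pow_ne_zero p hi⟩

/-- At a rational point, `∑ xⱼᵖ ∂ⱼ f` vanishes to second order along the tangent line: the Frobenius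
fixes the point and has derivative zero, so that Euler's identity for the derivatives of `f`
applies. -/
lemma eval_dirDeriv_frobPolar [CharP K p] {f : MvPolynomial (Fin 3) K} {d : ℕ}
    (hf : f.IsHomogeneous d) {P v : Fin 3 → K} {c : K} (hP : frob p P = c • P)
    (hv : grad f P ⬝ᵥ v = 0) : eval P (dirDeriv v (frobPolar p f)) = 0 := by
  have h0 : ∀ i j, pderiv i (X j ^ p : MvPolynomial (Fin 3) K) = 0 := fun i j => by
    rw [pderiv_pow, ← map_natCast (C : K →+* MvPolynomial (Fin 3) K), CharP.cast_eq_zero]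
    simp
  have h1 : eval P (dirDeriv v (frobPolar p f)) =
      eval P (dirDeriv (frob p P) (dirDeriv v f)) := by
    simp only [frobPolar, dirDeriv, map_sum, pderiv_mul, h0, zero_mul, zero_add, pderiv_C,
      Finset.mul_sum, map_mul, eval_C, map_pow, eval_X, frob]
    rw [Finset.sum_comm]
    refine Finset.sum_congr rfl fun j _ => Finset.sum_congr rfl fun i _ => ?_
    rw [pderiv_comm j i]
    ring
  have h2 : eval P (dirDeriv (c • P) (dirDeriv v f)) = c * eval P (dirDeriv P (dirDeriv v f)) := by
    simp [eval_dirDeriv, Finset.mul_sum, mul_assoc]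
  rw [h1, hP, h2, eval_dirDeriv_self (isHomogeneous_dirDeriv hf v), ← grad_dotProduct, hv, mul_zero,
    mul_zero]

variable [Algebra (ZMod p) K]

variable (K) in
/-- The base change from `𝔽_p` to `K` of a vector. -/
abbrev baseVec (x : Fin 3 → ZMod p) : Fin 3 → K := fun i => algebraMap (ZMod p) K (x i)

lemma baseVec_add (x y : Fin 3 → ZMod p) : baseVec K (x + y) = baseVec K x + baseVec K y := by
  funext i; simp [baseVec]

lemma baseVec_smul (a : ZMod p) (x : Fin 3 → ZMod p) :
    baseVec K (a • x) = algebraMap (ZMod p) K a • baseVec K x := by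
  funext i; simp [baseVec]

lemma baseVec_dotProduct (x y : Fin 3 → ZMod p) :
    baseVec K x ⬝ᵥ baseVec K y = algebraMap (ZMod p) K (x ⬝ᵥ y) := by
  simp [dotProduct]

variable [Fact p.Prime]

lemma baseVec_ne_zero {x : Fin 3 → ZMod p} (hx : x ≠ 0) : baseVec K x ≠ 0 := by
  obtain ⟨i, hi⟩ := Function.ne_iff.mp hx
  exact Function.ne_iff.mpr ⟨i, (map_ne_zero _).mpr hi⟩

lemma linearIndependent_baseVec {l m : Fin 3 → ZMod p} (h : LinearIndependent (ZMod p) ![l, m]) :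
    LinearIndependent K ![baseVec K l, baseVec K m] := by
  rw [← crossProduct_ne_zero_iff_linearIndependent] at h ⊢
  obtain ⟨i, hi⟩ := Function.ne_iff.mp h
  refine Function.ne_iff.mpr ⟨i, ?_⟩
  have : (baseVec K l ⨯₃ baseVec K m) i = algebraMap (ZMod p) K ((l ⨯₃ m) i) := by
    fin_cases i <;> simp [cross_apply]
  rw [this]
  exact (map_ne_zero _).mpr hi

lemma linearIndependent_baseVec_rep {L M : RatLine (ZMod p)} (h : L ≠ M) :
    LinearIndependent K ![baseVec K L.rep, baseVec K M.rep] :=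
  linearIndependent_baseVec (Projectivization.linearIndependent_pair_iff_ne.mpr h)

/-- Otherwise `X ^ p - X` would have more than `p` roots. -/
lemma mem_range_algebraMap_of_pow_eq {x : K} (hx : x ^ p = x) :
    x ∈ Set.range (algebraMap (ZMod p) K) := by
  by_contra h
  have hp := (Fact.out : p.Prime).one_lt
  have h0 : (Polynomial.X ^ p - Polynomial.X : Polynomial K) = 0 := by
    refine Polynomial.eq_zero_of_natDegree_lt_card_of_eval_eq_zero _
      (f := fun o : Option (ZMod p) => o.elim x (algebraMap (ZMod p) K)) ?_ ?_ ?_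
    · rintro (_ | a) (_ | b) hab
      · rfl
      · exact absurd ⟨b, hab.symm⟩ h
      · exact absurd ⟨a, hab⟩ h
      · exact congrArg some ((algebraMap (ZMod p) K).injective hab)
    · rintro (_ | a)
      · simp [hx]
      · simp [← map_pow, ZMod.pow_card]
    · rw [FiniteField.X_pow_card_sub_X_natDegree_eq K hp, Fintype.card_option, ZMod.card]
      omega
  exact FiniteField.X_pow_card_sub_X_ne_zero K hp h0

/-- A point of the plane fixed by the Frobenius is rational. -/
lemma exists_baseVec_of_frob_eq_smul {P : Fin 3 → K} (hP : P ≠ 0) {c : K}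
    (h : frob p P = c • P) :
    ∃ (Q : Fin 3 → ZMod p) (a : K), Q ≠ 0 ∧ a ≠ 0 ∧ P = a • baseVec K Q := by
  obtain ⟨i, hi⟩ := Function.ne_iff.mp hP
  rw [Pi.zero_apply] at hi
  have hc : ∀ j, P j ^ p = c * P j := fun j => congrFun h j
  have hfix : ∀ j, (P j / P i) ^ p = P j / P i := fun j => by
    have hc0 : c ≠ 0 := by
      rintro rfl
      exact pow_ne_zero p hi (by rw [hc, zero_mul])
    rw [div_pow, hc, hc, mul_div_mul_left _ _ hc0]
  choose Q hQ using fun j => mem_range_algebraMap_of_pow_eq (hfix j)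
  have hPQ : P = P i • baseVec K Q := by
    funext j
    simp only [baseVec, Pi.smul_apply, smul_eq_mul, hQ]
    rw [mul_div_cancel₀ _ hi]
  refine ⟨Q, P i, ?_, hi, hPQ⟩
  rintro rfl
  exact hP (by rw [hPQ]; funext j; simp)

variable [CharP K p]

lemma dotProduct_frob (l : Fin 3 → ZMod p) (x : Fin 3 → K) :
    baseVec K l ⬝ᵥ frob p x = (baseVec K l ⬝ᵥ x) ^ p := by
  have h : ∀ a : ZMod p, algebraMap (ZMod p) K a ^ p = algebraMap (ZMod p) K a := fun a => by
    rw [← map_pow, ZMod.pow_card]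
  simp [dotProduct, frob, Fin.sum_univ_three, add_pow_char, mul_pow, h]

lemma eval_frob (F : MvPolynomial (Fin 3) (ZMod p)) (x : Fin 3 → K) :
    eval (frob p x) (map (algebraMap (ZMod p) K) F) =
      (eval x (map (algebraMap (ZMod p) K) F)) ^ p := by
  rw [eval_map, eval_map, ← frobenius_def, hom_eval₂]
  congr 1
  exact Subsingleton.elim _ _

lemma grad_frob (F : MvPolynomial (Fin 3) (ZMod p)) (x : Fin 3 → K) :
    grad (map (algebraMap (ZMod p) K) F) (frob p x) =
      frob p (grad (map (algebraMap (ZMod p) K) F) x) := by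
  funext i
  simp only [grad, pderiv_map, eval_frob, frob]

/-- The Frobenius preserves tangency of rational lines to curves defined over `𝔽_p`. -/
lemma IsTangentAt.frob {F : MvPolynomial (Fin 3) (ZMod p)} {l : Fin 3 → ZMod p} {P : Fin 3 → K}
    (h : IsTangentAt (map (algebraMap (ZMod p) K) F) (baseVec K l) P) :
    IsTangentAt (map (algebraMap (ZMod p) K) F) (baseVec K l) (frob p P) where
  ne_zero := frob_ne_zero h.ne_zero
  mem_line := by rw [dotProduct_frob, h.mem_line, zero_pow (Fact.out : p.Prime).ne_zero]
  mem_curve := by rw [eval_frob, h.mem_curve, zero_pow (Fact.out : p.Prime).ne_zero]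
  exists_grad_eq := by
    obtain ⟨c, hc⟩ := h.exists_grad_eq
    refine ⟨c ^ p, ?_⟩
    rw [grad_frob, hc]
    funext i
    simp only [PlaneGeometry.frob, Pi.smul_apply, smul_eq_mul, mul_pow, baseVec]
    rw [← map_pow, ZMod.pow_card]

lemma IsTangentAt.eval_frobPolar_eq_zero {f : MvPolynomial (Fin 3) K} {l : Fin 3 → ZMod p}
    {P : Fin 3 → K} (h : IsTangentAt f (baseVec K l) P) : eval P (frobPolar p f) = 0 := by
  rw [eval_frobPolar]
  refine h.grad_dotProduct_eq_zero ?_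
  rw [dotProduct_frob, h.mem_line, zero_pow (Fact.out : p.Prime).ne_zero]

/-- If `f` divides `∑ xⱼᵖ ∂ⱼ f` and `d ≤ p + 1`, then a rational line tangent to the curve at
a nonrational point is contained in the curve: the restriction of `f` to the line vanishes to order
`p` at the point of tangency and to order two at its image under the Frobenius. -/
lemma eval_eq_zero_of_dvd_frobPolar [Infinite K] {F : MvPolynomial (Fin 3) (ZMod p)} {d : ℕ}
    (hF : (map (algebraMap (ZMod p) K) F).IsHomogeneous d) (hd1 : 1 ≤ d) (hd : d ≤ p + 1)
    (hdvd : map (algebraMap (ZMod p) K) F ∣ frobPolar p (map (algebraMap (ZMod p) K) F))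
    {l : Fin 3 → ZMod p} {P : Fin 3 → K}
    (h : IsTangentAt (map (algebraMap (ZMod p) K) F) (baseVec K l) P) (t : K) :
    eval (P + t • frob p P) (map (algebraMap (ZMod p) K) F) = 0 := by
  obtain ⟨g, hg⟩ := hdvd
  set f := map (algebraMap (ZMod p) K) F with hf
  revert t
  rw [← lineRestrict_eq_zero_iff]
  set q := lineRestrict f P (frob p P) with hq
  -- modulo `X ^ p`, the `p`-th powers of the coordinates are constant along the line
  have hpow : ∀ j, lineRestrict (X j ^ p) P (frob p P) =
      Polynomial.C (frob p P j) + Polynomial.X ^ p * Polynomial.C (frob p P j ^ p) := by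
    intro j
    have : lineRestrict (X j ^ p) P (frob p P) = (lineRestrict (X j) P (frob p P)) ^ p :=
      map_pow _ _ _
    rw [this, lineRestrict_X, add_pow_char, mul_pow, ← Polynomial.C_pow, ← Polynomial.C_pow]
    rfl
  have hode : Polynomial.derivative q + Polynomial.X ^ p *
      (∑ j, Polynomial.C (frob p P j ^ p) * lineRestrict (pderiv j f) P (frob p P)) =
      q * lineRestrict g P (frob p P) := by
    rw [← lineRestrict_mul, ← hg, hq, derivative_lineRestrict, frobPolar, dirDeriv,
      lineRestrict_sum, lineRestrict_sum, Finset.mul_sum, ← Finset.sum_add_distrib]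
    refine Finset.sum_congr rfl fun j _ => ?_
    rw [lineRestrict_mul, lineRestrict_mul, hpow, lineRestrict_C]
    ring
  have h0 : q.coeff 0 = 0 := by
    rw [Polynomial.coeff_zero_eq_eval_zero, hq, eval_lineRestrict, zero_smul, add_zero]
    exact h.mem_curve
  have hlow := coeff_eq_zero_of_derivative_eq h0 hode
  have htop : q.coeff d = 0 := by
    rw [hq, coeff_lineRestrict hF, h.frob.mem_curve]
  have hpred : q.coeff (d - 1) = 0 := by
    rw [hq, coeff_pred_lineRestrict hF hd1]
    exact h.frob.grad_dotProduct_eq_zero h.mem_line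
  ext i
  rw [Polynomial.coeff_zero]
  by_cases hi : i < p
  · exact hlow i hi
  · obtain h1 | h1 | h1 : i = d - 1 ∨ i = d ∨ d < i := by omega
    · rw [h1, hpred]
    · rw [h1, htop]
    · exact Polynomial.coeff_eq_zero_of_natDegree_lt
        ((natDegree_lineRestrict_le hF P (frob p P)).trans_lt h1)

end Frobenius

/-! ### Existence of a transverse line -/

section Existence

open Matrix

variable {K : Type*} [Field K] {p : ℕ} [Fact p.Prime] [Algebra (ZMod p) K]
  {F : MvPolynomial (Fin 3) (ZMod p)} {d : ℕ}

/-- The gradient of a linear form is constant, so that the form cannot be tangent to two different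
rational lines. -/
lemma exists_forall_not_isTangentAt_of_isHomogeneous_one
    (hF : (map (algebraMap (ZMod p) K) F).IsHomogeneous 1)
    (hs : ∀ x, x ≠ 0 → eval x (map (algebraMap (ZMod p) K) F) = 0 →
      grad (map (algebraMap (ZMod p) K) F) x ≠ 0) :
    ∃ L : RatLine (ZMod p), ∀ P,
      ¬ IsTangentAt (map (algebraMap (ZMod p) K) F) (baseVec K L.rep) P := by
  by_contra! H
  choose P hP using H
  set f := map (algebraMap (ZMod p) K) F with hf
  have hconst : ∀ x y, grad f x = grad f y := fun x y => funext fun i => by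
    have h := hF.pderiv (i := i)
    rw [Nat.sub_self, ← totalDegree_zero_iff_isHomogeneous, totalDegree_eq_zero_iff_eq_C] at h
    rw [grad, grad, h, eval_C, eval_C]
  let L : RatLine (ZMod p) := Projectivization.mk (ZMod p) (Pi.single 0 1) (by simp)
  let M : RatLine (ZMod p) := Projectivization.mk (ZMod p) (Pi.single 1 1) (by simp)
  have hLM : L ≠ M := by
    intro h
    obtain ⟨a, ha⟩ := (Projectivization.mk_eq_mk_iff' _ _ _ _ _).mp h
    simpa using congrFun ha 0
  obtain ⟨a, ha⟩ := (hP L).exists_grad_eq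
  obtain ⟨b, hb⟩ := (hP M).exists_grad_eq
  have h1 := (LinearIndependent.pair_iff.mp (linearIndependent_baseVec_rep (K := K) hLM) a (-b)
    (by rw [← ha, neg_smul, ← hb, hconst (P L) (P M), add_neg_cancel])).1
  exact hs _ (hP L).ne_zero (hP L).mem_curve (by rw [ha, h1, zero_smul])

variable [IsAlgClosed K] [CharP K p]

/-- For a smooth curve whose equation does not divide `∑ xⱼᵖ ∂ⱼ f`, some rational line is not
tangent. Otherwise choose a point of tangency `P L` on each rational line `L`. By Bézout's
inequality the number of rational lines is at most `d (d + p - 1) / 2`: if `P L` is not rational,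
it and its image under the Frobenius are common zeros of `f` and `∑ xⱼᵖ ∂ⱼ f`; if `P L` is rational,
it is a common zero counting twice. -/
lemma exists_forall_not_isTangentAt_of_not_dvd
    (hF : (map (algebraMap (ZMod p) K) F).IsHomogeneous d)
    (hF0 : map (algebraMap (ZMod p) K) F ≠ 0) (hd1 : 1 ≤ d) (hd : d ≤ p + 1)
    (hs : ∀ x, x ≠ 0 → eval x (map (algebraMap (ZMod p) K) F) = 0 →
      grad (map (algebraMap (ZMod p) K) F) x ≠ 0)
    (hdvd : ¬ map (algebraMap (ZMod p) K) F ∣ frobPolar p (map (algebraMap (ZMod p) K) F)) :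
    ∃ L : RatLine (ZMod p), ∀ P,
      ¬ IsTangentAt (map (algebraMap (ZMod p) K) F) (baseVec K L.rep) P := by
  classical
  by_contra! H
  choose P hP using H
  set f := map (algebraMap (ZMod p) K) F with hf
  have hprime : Prime f := (irreducible_of_forall_grad_ne_zero hF (by omega) hF0 hs).prime
  have : Fintype (RatLine (ZMod p)) := Fintype.ofFinite _
  have hv : ∀ L : RatLine (ZMod p), ∃ v, baseVec K L.rep ⬝ᵥ v = 0 ∧
      LinearIndependent K ![P L, v] := fun L =>
    exists_linearIndependent_of_dotProduct_eq_zero (hP L).ne_zero (hP L).mem_line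
  choose v hvL hvP using hv
  -- `R` is the set of lines with a rational point of tangency
  set R : Finset (RatLine (ZMod p)) :=
    Finset.univ.filter fun L => ¬ LinearIndependent K ![P L, frob p (P L)] with hR
  let Q : RatLine (ZMod p) ⊕ {L // L ∉ R} → Fin 3 → K :=
    Sum.elim P (fun L => frob p (P L))
  let line : RatLine (ZMod p) ⊕ {L // L ∉ R} → RatLine (ZMod p) :=
    Sum.elim id Subtype.val
  have hQ : ∀ i, IsTangentAt f (baseVec K (line i).rep) (Q i) := by
    rintro (L | L)
    · exact hP L
    · exact (hP L).frob
  have hQQ : ∀ i j, i ≠ j → LinearIndependent K ![Q i, Q j] := by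
    intro i j hij
    by_cases hl : line i = line j
    · have hmem : ∀ L : {L // L ∉ R}, LinearIndependent K ![P L, frob p (P L)] := fun L => by
        simpa [hR] using L.2
      rcases i with L | L <;> rcases j with M | M
      · exact absurd (congrArg Sum.inl hl) hij
      · obtain rfl : L = M.1 := hl
        exact hmem M
      · obtain rfl : L.1 = M := hl
        exact LinearIndependent.pair_symm_iff.mp (hmem L)
      · exact absurd (congrArg Sum.inr (Subtype.ext hl)) hij
    · exact linearIndependent_of_isTangentAt hF hs (linearIndependent_baseVec_rep hl) (hQ i) (hQ j)
  have hbez := card_add_card_le_mul hF (isHomogeneous_frobPolar hF) hprime hdvd Q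
    (fun i => (hQ i).ne_zero) hQQ (fun i => (hQ i).mem_curve)
    (fun i => (hQ i).eval_frobPolar_eq_zero) (fun i => v (line i)) (R.map Function.Embedding.inl)
    (by
      intro i hi
      obtain ⟨L, -, rfl⟩ := Finset.mem_map.mp hi
      exact hvP L)
    (by
      intro i _
      rw [← grad_dotProduct]
      exact (hQ i).grad_dotProduct_eq_zero (hvL (line i)))
    (by
      intro i hi
      obtain ⟨L, hL, rfl⟩ := Finset.mem_map.mp hi
      obtain ⟨c, -, hc⟩ := exists_eq_smul_of_not_linearIndependent (hP L).ne_zero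
        (frob_ne_zero (hP L).ne_zero) (Finset.mem_filter.mp hL).2
      exact eval_dirDeriv_frobPolar hF hc ((hP L).grad_dotProduct_eq_zero (hvL L)))
  have hcard : Fintype.card (RatLine (ZMod p)) = 1 + p + p ^ 2 := by
    rw [← Nat.card_eq_fintype_card, Projectivization.card_of_finrank (ZMod p) (Fin 3 → ZMod p)
      (n := 3) (by simp)]
    simp [Finset.sum_range_succ]
  have hsub : Fintype.card {L // L ∉ R} + R.card = Fintype.card (RatLine (ZMod p)) := by
    rw [Fintype.card_subtype_compl, Fintype.card_coe]
    exact Nat.sub_add_cancel (Finset.card_le_univ R)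
  rw [Fintype.card_sum, Finset.card_map] at hbez
  have hmul : d * (p + (d - 1)) ≤ (p + 1) * (p + p) := Nat.mul_le_mul hd (by omega)
  nlinarith

/-- If the equation of a smooth curve of degree `2 ≤ d ≤ p + 1` divides `∑ xⱼᵖ ∂ⱼ f`, then some
rational line is not tangent. Otherwise all rational lines are tangent at rational points, so that
all rational points of the plane lie on the curve, there being as many points as lines. But then
a rational line meets the curve in more than `d` points, counted with multiplicity. -/
lemma exists_forall_not_isTangentAt_of_dvd
    (hF : (map (algebraMap (ZMod p) K) F).IsHomogeneous d) (hd2 : 2 ≤ d) (hd : d ≤ p + 1)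
    (hs : ∀ x, x ≠ 0 → eval x (map (algebraMap (ZMod p) K) F) = 0 →
      grad (map (algebraMap (ZMod p) K) F) x ≠ 0)
    (hdvd : map (algebraMap (ZMod p) K) F ∣ frobPolar p (map (algebraMap (ZMod p) K) F)) :
    ∃ L : RatLine (ZMod p), ∀ P,
      ¬ IsTangentAt (map (algebraMap (ZMod p) K) F) (baseVec K L.rep) P := by
  classical
  have : Infinite K := IsAlgClosed.instInfinite
  by_contra! H
  choose P hP using H
  set f := map (algebraMap (ZMod p) K) F with hf
  have hnoline : ∀ u w : Fin 3 → K, LinearIndependent K ![u, w] →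
      ¬ ∀ t : K, eval (u + t • w) f = 0 := by
    intro u w huw h
    obtain ⟨x, hx, h1, h2⟩ := exists_singular_of_line hF hd2 huw h
    exact hs x hx h1 h2
  have hrat : ∀ L : RatLine (ZMod p), ∃ Q : Fin 3 → ZMod p, Q ≠ 0 ∧
      IsTangentAt f (baseVec K L.rep) (baseVec K Q) := by
    intro L
    have hdep : ¬ LinearIndependent K ![P L, frob p (P L)] := fun h =>
      hnoline _ _ h (eval_eq_zero_of_dvd_frobPolar hF (by omega) hd hdvd (hP L))
    obtain ⟨c, -, hc⟩ := exists_eq_smul_of_not_linearIndependent (hP L).ne_zero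
      (frob_ne_zero (hP L).ne_zero) hdep
    obtain ⟨Q, a, hQ, ha, hPQ⟩ := exists_baseVec_of_frob_eq_smul (hP L).ne_zero hc
    refine ⟨Q, hQ, ?_⟩
    have := (hP L).smul hF (inv_ne_zero ha)
    rwa [hPQ, smul_smul, inv_mul_cancel₀ ha, one_smul] at this
  choose Q hQ0 hQ using hrat
  -- the point of tangency determines the line, so that all rational points are points of tangency
  let point : RatLine (ZMod p) → Projectivization (ZMod p) (Fin 3 → ZMod p) :=
    fun L => Projectivization.mk (ZMod p) (Q L) (hQ0 L)
  have hinj : Function.Injective point := by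
    intro L M hLM
    by_contra hne
    obtain ⟨a, ha⟩ := (Projectivization.mk_eq_mk_iff' _ _ _ _ _).mp hLM
    have h1 := linearIndependent_of_isTangentAt hF hs
      (linearIndependent_baseVec_rep (Ne.symm hne)) (hQ M) (hQ L)
    rw [LinearIndependent.pair_iff' (hQ M).ne_zero] at h1
    refine h1 (algebraMap (ZMod p) K a) ?_
    rw [← ha, baseVec_smul]
  have hsurj := Finite.surjective_of_injective hinj
  have hall : ∀ x : Fin 3 → ZMod p, x ≠ 0 → eval (baseVec K x) f = 0 := by
    intro x hx
    obtain ⟨L, hL⟩ := hsurj (Projectivization.mk (ZMod p) x hx)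
    obtain ⟨a, ha⟩ := (Projectivization.mk_eq_mk_iff' _ _ _ _ _).mp hL.symm
    have : baseVec K x = algebraMap (ZMod p) K a • baseVec K (Q L) := by
      rw [← ha, baseVec_smul]
    rw [this, eval_smul_of_isHomogeneous hF, (hQ L).mem_curve, mul_zero]
  -- restrict the equation to an arbitrary rational line
  have L : RatLine (ZMod p) := Projectivization.mk (ZMod p) (Pi.single 0 1) (by simp)
  have hQL : L.rep ⬝ᵥ Q L = 0 := by
    have := (hQ L).mem_line
    rw [baseVec_dotProduct] at this
    exact (map_eq_zero _).mp this
  obtain ⟨w, hw, hQw⟩ := exists_linearIndependent_of_dotProduct_eq_zero (hQ0 L) hQL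
  refine hnoline _ _ (linearIndependent_baseVec hQw) ?_
  rw [← lineRestrict_eq_zero_iff]
  set q := lineRestrict f (baseVec K (Q L)) (baseVec K w) with hq
  have hq0 : q.coeff 0 = 0 := by
    rw [Polynomial.coeff_zero_eq_eval_zero, hq, eval_lineRestrict, zero_smul, add_zero]
    exact (hQ L).mem_curve
  -- `q = X q₁`, and `q₁` vanishes on `𝔽_p`, at zero because of the tangency; its degree is less
  -- than `p`, since `q` also vanishes at the point at infinity `w` of the line
  obtain ⟨q₁, hq₁⟩ := Polynomial.X_dvd_iff.mpr hq0
  suffices h : q₁ = 0 by rw [hq₁, h, mul_zero]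
  refine Polynomial.eq_zero_of_natDegree_lt_card_of_eval_eq_zero _
    (f := fun a : ZMod p => algebraMap (ZMod p) K a) (algebraMap (ZMod p) K).injective
    (fun a => ?_) ?_
  · by_cases ha : a = 0
    · have h1 : (Polynomial.derivative q).eval 0 = 0 := by
        rw [hq, derivative_lineRestrict, eval_lineRestrict, zero_smul, add_zero, ← grad_dotProduct]
        refine (hQ L).grad_dotProduct_eq_zero ?_
        rw [baseVec_dotProduct, hw, map_zero]
      rw [hq₁] at h1
      simpa [ha] using h1
    · have h1 : q.eval (algebraMap (ZMod p) K a) = 0 := by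
        rw [hq, eval_lineRestrict]
        have h2 := hall _ (ne_zero_of_linearIndependent_pair hQw a)
        rwa [baseVec_add, baseVec_smul] at h2
      rw [hq₁, Polynomial.eval_mul, Polynomial.eval_X] at h1
      exact (mul_eq_zero.mp h1).resolve_left ((map_ne_zero _).mpr ha)
  · rw [ZMod.card]
    by_contra! hlt
    have hp := (Fact.out : p.Prime).pos
    have hne : q₁ ≠ 0 := by
      rintro rfl
      rw [Polynomial.natDegree_zero] at hlt
      omega
    have hdeg : q.natDegree = q₁.natDegree + 1 := by
      rw [hq₁, Polynomial.natDegree_X_mul hne]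
    have hle := natDegree_lineRestrict_le hF (baseVec K (Q L)) (baseVec K w)
    rw [← hq] at hle
    have hqd : q.natDegree = d := by omega
    have htop : q.coeff d = 0 := by
      rw [hq, coeff_lineRestrict hF]
      exact hall w (by simpa using hQw.ne_zero 1)
    rw [← hqd, Polynomial.coeff_natDegree, Polynomial.leadingCoeff_eq_zero] at htop
    rw [htop, Polynomial.natDegree_zero] at hdeg
    omega

end Existence

/-- The smoothness condition at the geometric points of a curve, in terms of homogeneous
coordinates. -/
lemma PlaneCurve.IsSmooth.grad_ne_zero {k : Type*} [Field k] {C : PlaneCurve k} (hC : C.IsSmooth)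
    (x : Fin 3 → AlgebraicClosure k) (hx : x ≠ 0)
    (h : eval x (map (algebraMap k (AlgebraicClosure k)) C.form) = 0) :
    grad (map (algebraMap k (AlgebraicClosure k)) C.form) x ≠ 0 := by
  have hF := C.isHomogeneous.map (algebraMap k (AlgebraicClosure k))
  obtain ⟨a, ha⟩ := Projectivization.exists_smul_eq_mk_rep (AlgebraicClosure k) x hx
  have hmem : Projectivization.mk (AlgebraicClosure k) x hx ∈ C.geomPoints := by
    rw [geomPoints, Set.mem_ofPred_eq, aeval_def, ← eval_map, ← ha, Units.smul_def,
      eval_smul_of_isHomogeneous hF, h, mul_zero]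
  obtain ⟨i, hi⟩ := hC _ hmem
  rw [aeval_def, ← eval_map, ← pderiv_map, ← ha, Units.smul_def,
    eval_smul_of_isHomogeneous hF.pderiv] at hi
  exact fun h0 => hi (by rw [show eval x _ = 0 from congrFun h0 i, mul_zero])

end PlaneGeometry

open MvPolynomial PlaneGeometry in
theorem mainTheorem2 (p : ℕ) [Fact p.Prime] (hp : 2 < p)
    (C : PlaneGeometry.PlaneCurve (ZMod p)) (hC : C.IsSmooth) (hd : C.degree ≤ p + 1) :
    ∃ L : PlaneGeometry.RatLine (ZMod p), PlaneGeometry.MeetsTransversely L C := by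
  have hF := C.isHomogeneous.map (algebraMap (ZMod p) (AlgebraicClosure (ZMod p)))
  have hF0 : map (algebraMap (ZMod p) (AlgebraicClosure (ZMod p))) C.form ≠ 0 :=
    (map_ne_zero_iff _ (map_injective _ (algebraMap (ZMod p) _).injective)).mpr C.form_ne_zero
  have hs := hC.grad_ne_zero
  obtain ⟨L, hL⟩ : ∃ L : RatLine (ZMod p), ∀ P, ¬ IsTangentAt
      (map (algebraMap (ZMod p) (AlgebraicClosure (ZMod p))) C.form)
      (baseVec (AlgebraicClosure (ZMod p)) L.rep) P := by
    by_cases hd1 : C.degree = 1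
    · exact exists_forall_not_isTangentAt_of_isHomogeneous_one (hd1 ▸ hF) hs
    · have := C.degree_pos
      by_cases hdvd : map (algebraMap (ZMod p) (AlgebraicClosure (ZMod p))) C.form ∣
          frobPolar p (map (algebraMap (ZMod p) (AlgebraicClosure (ZMod p))) C.form)
      · exact exists_forall_not_isTangentAt_of_dvd hF (by omega) hd hs hdvd
      · exact exists_forall_not_isTangentAt_of_not_dvd hF hF0 (by omega) hd hs hdvd
  refine ⟨L, ?_⟩
  have h := encard_inter_eq_of_forall_not_isTangentAt hF (baseVec_ne_zero L.rep_nonzero) hL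
  rw [MeetsTransversely, ← h]
  congr 1
  ext P
  simp only [PlaneCurve.geomPoints, RatLine.geomPoints, Set.mem_inter_iff, Set.mem_ofPred_eq,
    aeval_def, ← eval_map]
  rfl
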